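/- Consider a sequence of stochastic block models whose number of vertices $N$ tends to infinity. The vertex set $V$ of size $N$ is divided into $M=M(N)$ disjoint blocks of equal size $N/M$, where $M$ divides $N$ and $M=o(N)$ (for instance, $M$ is constant), and $p=p(N),q=q(N)\in[0,1]$. Every unordered pair $\{v,w\}$ of vertices (with $v=w$ allowed, so that loops occur) is an edge, independently of all other pairs, with probability $p$ if $v,w$ lie in the same block and with probability $q$ otherwise. The degree $d_v$ of a vertex is the number of $w\in V$ such that $\{v,w\}$ is an edge. For simple random walk on a realization of this random graph (from $v$, the next position is uniform among the $d_v$ neighbours of $v$), let $H_{vw}\in[0,\infty]$ be the expected time that the walk started at $v$ takes to reach $w$ (so $H_{vv}=0$), let $\pi_w=d_w/\sum_{u\in V}d_u$, and set $$H^v=\sum_{w\in V}\pi_w H_{vw}.$$ **Theorem.** Assume that $$\frac{M\log^4 N}{Np+N(M-1)q}\longrightarrow 0\qquad\text{and}\qquad q\gg\sqrt{\frac{p\log N}{NM}}\,,$$ and that the limit $\kappa=\lim_{N\to\infty}\frac{(M-1)q}{p}\in[0,\infty]$ exists. Then $H^v=N(1+o(1))$ asymptotically almost surely; that is, for every $\varepsilon>0$,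 $$\mathbb P\left(\,H^v<\infty\ \text{ and }\ \left|\frac{H^v}{N}-1\right|\le\varepsilon\ \text{ for all } v\in V\right)\longrightarrow 1 .$$ Here $a\gg b$ means $b=o(a)$, and the first condition means $M\log^4N=o(Np+N(M-1)q)$. -/

import Mathlib

open MeasureTheory ProbabilityTheory Filter Topology Asymptotics
open scoped ENNReal

namespace StochasticBlockModel

/-- A realization of a graph on the vertices `0, …, N - 1`, in which loops are allowed: for every
unordered pair `s(v, w)`, where `v = w` is possible, it records whether `{v, w}` is an edge. -/
abbrev EdgeConfig (N : ℕ) : Type := Sym2 (Fin N) → Bool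

/-- The probability of the edge `e`, for the block assignment `B`: it is `p` if both endpoints lie
in the same block, and `q` otherwise. -/
def edgeProb {N M : ℕ} (B : Fin N → Fin M) (p q : unitInterval) (e : Sym2 (Fin N)) :
    unitInterval :=
  Sym2.lift ⟨fun v w => if B v = B w then p else q, fun v w => by simp only [eq_comm]⟩ e

/-- The law of the stochastic block model: all edges (loops included) are independent, and the
edge `e` is present with probability `edgeProb B p q e`. -/
noncomputable def law {N M : ℕ} (B : Fin N → Fin M) (p q : unitInterval) :
    Measure (EdgeConfig N) :=
  Measure.pi fun e => bernoulliMeasure true false (edgeProb B p q e)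

/-- The neighbours of `v`; the vertex `v` itself is one of them if there is a loop at `v`. -/
def neighbors {N : ℕ} (G : EdgeConfig N) (v : Fin N) : Finset (Fin N) :=
  Finset.univ.filter fun w => G s(v, w) = true

/-- The degree of `v`; a loop at `v` counts once. -/
def degree {N : ℕ} (G : EdgeConfig N) (v : Fin N) : ℕ := (neighbors G v).card

/-- The law of one step of simple random walk from `v`: a uniformly chosen neighbour of `v`.
(If `v` has no neighbour, then the walk stays at `v`.) -/
noncomputable def stepLaw {N : ℕ} (G : EdgeConfig N) (v : Fin N) : Measure (Fin N) :=
  if (neighbors G v).Nonempty then uniformOn (neighbors G v : Set (Fin N)) else Measure.dirac v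

instance {N : ℕ} (G : EdgeConfig N) (v : Fin N) : IsProbabilityMeasure (stepLaw G v) := by
  unfold stepLaw
  split_ifs with h
  · exact isProbabilityMeasure_uniformOn (Finset.finite_toSet _) (by exact_mod_cast h)
  · infer_instance

/-- The transition kernel of simple random walk on `G`. -/
noncomputable def stepKernel {N : ℕ} (G : EdgeConfig N) : Kernel (Fin N) (Fin N) :=
  Kernel.ofFunOfCountable (stepLaw G)

instance {N : ℕ} (G : EdgeConfig N) : IsMarkovKernel (stepKernel G) :=
  ⟨fun v => inferInstanceAs (IsProbabilityMeasure (stepLaw G v))⟩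

/-- The transition kernel at time `n`, as a kernel from the history `X₀, …, Xₙ` of the walk:
it depends on the present position `Xₙ` only. -/
noncomputable def historyKernel {N : ℕ} (G : EdgeConfig N) (n : ℕ) :
    Kernel (Finset.Iic n → Fin N) (Fin N) :=
  (stepKernel G).comap (fun h => h ⟨n, Finset.mem_Iic.2 le_rfl⟩) (measurable_pi_apply _)

instance {N : ℕ} (G : EdgeConfig N) (n : ℕ) : IsMarkovKernel (historyKernel G n) := by
  unfold historyKernel
  infer_instance

/-- The law, on the space of trajectories, of simple random walk `(X₀, X₁, …)` on `G`
started at `X₀ = v`. -/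
noncomputable def walkLaw {N : ℕ} (G : EdgeConfig N) (v : Fin N) : Measure (ℕ → Fin N) :=
  Kernel.trajMeasure (X := fun _ => Fin N) (Measure.dirac v) (historyKernel G)

/-- The first time `t ≥ 0` at which the trajectory `x` is at `w` (infinite if there is none). -/
noncomputable def hittingTime {N : ℕ} (w : Fin N) (x : ℕ → Fin N) : ℕ∞ :=
  hittingAfter (fun (t : ℕ) (y : ℕ → Fin N) => y t) {w} 0 x

/-- `H_{vw}`: the expected time that simple random walk started at `v` takes to reach `w`. -/
noncomputable def expectedHittingTime {N : ℕ} (G : EdgeConfig N) (v w : Fin N) : ℝ≥0∞ :=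
  ∫⁻ x, ((hittingTime w x : ℕ∞) : ℝ≥0∞) ∂(walkLaw G v)

/-- The invariant distribution `π_w = d_w / ∑ u, d_u` of simple random walk. -/
noncomputable def invariantProb {N : ℕ} (G : EdgeConfig N) (w : Fin N) : ℝ≥0∞ :=
  (degree G w : ℝ≥0∞) / ∑ u, (degree G u : ℝ≥0∞)

/-- `H^v = ∑ w, π_w H_{vw}`: the expected hitting time from `v`, averaged over the target. -/
noncomputable def targetAveragedHittingTime {N : ℕ} (G : EdgeConfig N) (v : Fin N) : ℝ≥0∞ :=
  ∑ w, invariantProb G w * expectedHittingTime G v w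

end StochasticBlockModel

namespace StochasticBlockModel

/-! Let `P` be the transition operator, `A` the adjacency matrix, `d_v` the degrees, `W` their sum
and `π_w = d_w / W`. On degree-centred functions `I - P` is invertible, which yields centred `g_w`
with `(I - P) g_w = 1_w / π_w - 1`; then `H_{vw} = g_w(w) - g_w(v)`. The function `∑ w, π_w g_w` is
harmonic and centred, hence zero, so `H^v = ∑ w, π_w g_w(w)` is the same for every `v` (random
target lemma).

Splitting off two terms of the Neumann series of `(I - P)⁻¹` gives `π_w g_w(w) = 1 - 2π_w + A_ww /
d_w + R_w` with `0 ≤ R_w ≤ 1/(γδ)`, where `γ` is the spectral gap and `δ` a lower bound for the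
degrees; the factor `1/δ` is a bound for two-step return probabilities. Hence `N - 2 ≤ H^v ≤ N (1 +
1/δ + 1/(γδ))` (`exists_hitting_of_hasGap`), and it suffices that `δ` and `γδ` tend to infinity.

Cheeger's inequality is strong enough for this: with degrees of order `d` and cuts of density `ρ`,
`hasGap_of_cut` gives `γδ` of order at least `(ρN)² / d`. Chernoff and union bounds
(`measureReal_not_isExpanding_le`) show that, with high probability, degrees are within a factor two
of their mean `d = (Np + N(M-1)q)/M` and `ρ` is of order `q` (of order `p` if `M = 1`). For `M ≥ 2`,
`d/(qN)² ≤ p/(NMq²) + 1/(Nq)`; the assumption on `q` makes the first term small, and both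
assumptions together force `Nq ≫ log N`. -/

/-! ### Expected hitting times as solutions of one-step equations. -/

lemma toENNReal_eq_tsum (T : ℕ∞) : (T : ℝ≥0∞) = ∑' n : ℕ, if (n : ℕ∞) < T then (1 : ℝ≥0∞) else 0 := by
  induction T using ENat.recTopCoe with
  | top => simp
  | coe k =>
    rw [tsum_eq_sum (s := Finset.range k)]
    · rw [Finset.sum_congr rfl (g := fun _ => (1 : ℝ≥0∞))]
      · simp
      · intro n hn
        simp [Finset.mem_range.1 hn]
    · intro n hn
      simp at hn
      simp [hn]

/-- The trajectories that avoid `w` up to time `n`. -/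
def avoiding {N : ℕ} (w : Fin N) (n : ℕ) : Set (ℕ → Fin N) := {x | ∀ i ≤ n, x i ≠ w}

lemma measurableSet_avoiding {N : ℕ} (w : Fin N) (n : ℕ) : MeasurableSet (avoiding w n) := by
  have : avoiding w n = ⋂ i ∈ Set.Iic n, (fun x : ℕ → Fin N => x i) ⁻¹' {w}ᶜ := by
    ext x; simp [avoiding]
  rw [this]
  exact MeasurableSet.biInter (Set.to_countable _)
    fun i _ => (measurable_pi_apply i) (MeasurableSet.of_discrete)

lemma lt_hittingTime_iff {N : ℕ} (w : Fin N) (n : ℕ) (x : ℕ → Fin N) :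
    (n : ℕ∞) < hittingTime w x ↔ x ∈ avoiding w n := by
  constructor
  · intro h i hi hx
    have : hittingTime w x ≤ (i : ℕ∞) :=
      hittingAfter_le_of_mem (u := fun (t : ℕ) (y : ℕ → Fin N) => y t) (Nat.zero_le i) hx
    have h2 : (n : ℕ∞) < (i : ℕ∞) := lt_of_lt_of_le h this
    exact absurd (Nat.cast_lt.1 h2) (by omega)
  · intro h
    by_contra hle
    push Not at hle
    have hne : hittingTime w x ≠ ⊤ := ne_top_of_le_ne_top (ENat.natCast_ne_top n) hle
    have hmem := hittingAfter_mem_set_of_ne_top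
      (u := fun (t : ℕ) (y : ℕ → Fin N) => y t) (s := {w}) (n := 0) (ω := x) hne
    obtain ⟨k, hk⟩ := ENat.ne_top_iff_exists.1 hne
    have hk' : hittingAfter (fun (t : ℕ) (y : ℕ → Fin N) => y t) {w} 0 x = (k : WithTop ℕ) := hk.symm
    rw [hk'] at hmem
    rw [← hk] at hle
    exact h k (Nat.cast_le.1 hle) hmem

/-- Tail-sum formula: the hitting time exceeds `n` exactly when the positions at times `0, …, n` all
avoid `w`. -/
lemma expectedHittingTime_eq_tsum {N : ℕ} (G : EdgeConfig N) (v w : Fin N) :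
    expectedHittingTime G v w = ∑' n : ℕ, walkLaw G v (avoiding w n) := by
  unfold expectedHittingTime
  have : ∀ x : ℕ → Fin N, ((hittingTime w x : ℕ∞) : ℝ≥0∞) =
      ∑' n : ℕ, (avoiding w n).indicator (fun _ => (1 : ℝ≥0∞)) x := by
    intro x
    rw [toENNReal_eq_tsum]
    refine tsum_congr fun n => ?_
    by_cases hx : x ∈ avoiding w n
    · rw [if_pos ((lt_hittingTime_iff w n x).2 hx), Set.indicator_of_mem hx]
    · rw [if_neg (fun h => hx ((lt_hittingTime_iff w n x).1 h)), Set.indicator_of_notMem hx]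
  rw [lintegral_congr this, lintegral_tsum]
  · congr 1
    ext n
    rw [lintegral_indicator_const (measurableSet_avoiding w n), one_mul]
  · intro n
    exact (measurable_const.indicator (measurableSet_avoiding w n)).aemeasurable

lemma lintegral_eval_zero_walkLaw {N : ℕ} (G : EdgeConfig N) (v : Fin N) (f : Fin N → ℝ≥0∞) :
    ∫⁻ x, f (x 0) ∂(walkLaw G v) = f v := by
  have h0 : (walkLaw G v).map (fun x => x 0) = Measure.dirac v := by
    unfold walkLaw Kernel.trajMeasure
    have hc : (fun x : ℕ → Fin N => x 0) =
        (fun y : (i : Finset.Iic 0) → Fin N => y ⟨0, by simp⟩) ∘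
          Preorder.frestrictLe (π := fun _ => Fin N) 0 := rfl
    rw [hc, ← Measure.map_map (measurable_pi_apply _) (by fun_prop),
      Measure.map_comp _ _ (by fun_prop), Kernel.traj_map_frestrictLe, Kernel.partialTraj_self,
      Measure.id_comp, Measure.map_map (measurable_pi_apply _) (by fun_prop),
      Measure.map_dirac' (by fun_prop)]
    rfl
  rw [← lintegral_map (f := f) (g := fun x : ℕ → Fin N => x 0) Measurable.of_discrete
    (measurable_pi_apply 0), h0, lintegral_dirac]

/-- Markov property at time `n`, on an event determined by the history up to `n`; it follows from
the disintegration of the law of `(X₀, …, Xₙ, Xₙ₊₁)` along the history. -/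
lemma lintegral_avoiding_succ {N : ℕ} (G : EdgeConfig N) (v w : Fin N) (n : ℕ) (f : Fin N → ℝ≥0∞) :
    ∫⁻ x in avoiding w n, f (x (n + 1)) ∂(walkLaw G v) =
      ∫⁻ x in avoiding w n, (∫⁻ y, f y ∂(stepLaw G (x n))) ∂(walkLaw G v) := by
  have key := Kernel.map_frestrictLe_trajMeasure_compProd_eq_map_trajMeasure
    (X := fun _ => Fin N) (μ₀ := Measure.dirac v) (κ := historyKernel G) (a := n)
  set A : Set ((i : Finset.Iic n) → Fin N) := {y | ∀ i, y i ≠ w}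
  have hA : MeasurableSet A := MeasurableSet.of_discrete
  have hpre : (Preorder.frestrictLe (π := fun _ => Fin N) n) ⁻¹' A = avoiding w n := by
    ext x; simp [A, avoiding]
  set F : ((i : Finset.Iic n) → Fin N) × Fin N → ℝ≥0∞ := fun z => A.indicator (fun _ => f z.2) z.1
  have hF : Measurable F := Measurable.of_discrete
  have h1 : ∫⁻ z, F z ∂((walkLaw G v).map (fun x ↦ (Preorder.frestrictLe n x, x (n + 1)))) =
      ∫⁻ x in avoiding w n, f (x (n + 1)) ∂(walkLaw G v) := by
    rw [lintegral_map hF (by fun_prop), ← lintegral_indicator (measurableSet_avoiding w n)]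
    congr 1
    ext x
    rw [← hpre]
    rfl
  rw [← h1]
  unfold walkLaw at *
  rw [← key, Measure.lintegral_compProd hF, lintegral_map Measurable.of_discrete (by fun_prop),
    ← lintegral_indicator (measurableSet_avoiding w n)]
  congr 1
  ext x
  by_cases hx : x ∈ avoiding w n
  · have hx' : Preorder.frestrictLe (π := fun _ => Fin N) n x ∈ A := by
      rw [← Set.mem_preimage, hpre]; exact hx
    simp only [F, Set.indicator_of_mem hx', Set.indicator_of_mem hx]
    simp [historyKernel, stepKernel, Kernel.comap_apply]
    rfl
  · have hx' : Preorder.frestrictLe (π := fun _ => Fin N) n x ∉ A := by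
      rw [← Set.mem_preimage, hpre]; exact hx
    simp only [F, Set.indicator_of_notMem hx', Set.indicator_of_notMem hx]
    simp

lemma lintegral_stepLaw {N : ℕ} (G : EdgeConfig N) (v : Fin N) (hv : 0 < degree G v)
    (f : Fin N → ℝ≥0∞) :
    ∫⁻ y, f y ∂(stepLaw G v) = (∑ y ∈ neighbors G v, f y) / degree G v := by
  classical
  have hne : (neighbors G v).Nonempty := Finset.card_pos.1 hv
  rw [lintegral_fintype, ENNReal.div_eq_inv_mul, Finset.mul_sum]
  simp only [stepLaw, if_pos hne]
  rw [← Finset.sum_subset (Finset.subset_univ (neighbors G v))]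
  · refine Finset.sum_congr rfl fun y hy => ?_
    rw [← Finset.coe_singleton, uniformOn_apply_finset, Finset.inter_singleton_of_mem hy]
    simp [degree, mul_comm]
  · intro y _ hy
    rw [← Finset.coe_singleton, uniformOn_apply_finset, Finset.inter_singleton_of_notMem hy]
    simp

instance {N : ℕ} (G : EdgeConfig N) (v : Fin N) : IsProbabilityMeasure (walkLaw G v) := by
  unfold walkLaw; infer_instance

/-- A nonnegative solution of the one-step equations is the expected hitting time. -/
theorem expectedHittingTime_eq_of_step {N : ℕ} (G : EdgeConfig N) (w : Fin N)
    (h : Fin N → ℝ≥0∞) (hfin : ∀ u, h u ≠ ∞) (hw : h w = 0)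
    (hstep : ∀ u, u ≠ w → h u = 1 + ∫⁻ y, h y ∂(stepLaw G u)) (v : Fin N) :
    expectedHittingTime G v w = h v := by
  classical
  set a : ℕ → ℝ≥0∞ := fun n => walkLaw G v (avoiding w n)
  set b : ℕ → ℝ≥0∞ := fun n => ∫⁻ x in avoiding w n, h (x n) ∂(walkLaw G v)
  have hb0 : b 0 = h v := by
    rw [← lintegral_eval_zero_walkLaw G v h]
    change ∫⁻ x in avoiding w 0, h (x 0) ∂(walkLaw G v) = _
    rw [← lintegral_indicator (measurableSet_avoiding w 0)]
    congr 1
    ext x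
    by_cases hx : x 0 = w
    · simp [avoiding, hx, hw]
    · simp [avoiding, hx]
  have hbs : ∀ n, b n = a n + b (n + 1) := by
    intro n
    -- Since `h w = 0`, the condition of avoiding `w` at time `n + 1` can be dropped.
    have e1 : b (n + 1) = ∫⁻ x in avoiding w n, h (x (n + 1)) ∂(walkLaw G v) := by
      change ∫⁻ x in avoiding w (n + 1), h (x (n + 1)) ∂(walkLaw G v) = _
      rw [← lintegral_indicator (measurableSet_avoiding w _),
        ← lintegral_indicator (measurableSet_avoiding w _)]
      refine lintegral_congr fun x => ?_
      by_cases hx : x (n + 1) = w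
      · simp [Set.indicator_apply, hx, hw]
      · have : x ∈ avoiding w (n + 1) ↔ x ∈ avoiding w n := by
          constructor
          · intro hh i hi; exact hh i (by omega)
          · intro hh i hi
            rcases Nat.lt_or_ge i (n + 1) with h1 | h1
            · exact hh i (by omega)
            · obtain rfl : i = n + 1 := by omega
              exact hx
        simp [Set.indicator_apply, this]
    have e2 : a n = ∫⁻ x in avoiding w n, 1 ∂(walkLaw G v) := by simp [a]
    rw [e1, lintegral_avoiding_succ, e2, ← lintegral_add_left measurable_const]
    refine setLIntegral_congr_fun (measurableSet_avoiding w n) fun x hx => ?_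
    exact hstep _ (hx n le_rfl)
  have hsum : ∀ n, h v = ∑ i ∈ Finset.range n, a i + b n := by
    intro n
    induction n with
    | zero => simp [hb0]
    | succ n ih => rw [Finset.sum_range_succ, ih, hbs n, add_assoc]
  -- The telescoped identity bounds the tail sum by the finite `h v`. So the avoidance probabilities
  -- tend to zero, and the remainder `b n ≤ C * a n` vanishes with them; no separate recurrence
  -- argument is needed.
  have hle : ∑' i, a i ≤ h v := by
    rw [ENNReal.tsum_eq_iSup_nat]
    exact iSup_le fun n => by rw [hsum n]; exact le_self_add
  have ha0 : Tendsto a atTop (𝓝 0) :=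
    ENNReal.tendsto_atTop_zero_of_tsum_ne_top (ne_top_of_le_ne_top (hfin v) hle)
  set C : ℝ≥0∞ := ∑ u, h u
  have hC : C ≠ ∞ := by simp [C, hfin]
  have hbC : ∀ n, b n ≤ C * a n := by
    intro n
    calc b n ≤ ∫⁻ x in avoiding w n, C ∂(walkLaw G v) :=
          lintegral_mono fun x => Finset.single_le_sum (f := h) (fun _ _ => zero_le) (Finset.mem_univ _)
      _ = C * a n := by simp [a]
  have hb : Tendsto b atTop (𝓝 0) := by
    have : Tendsto (fun n => C * a n) atTop (𝓝 (C * 0)) :=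
      ENNReal.Tendsto.const_mul ha0 (Or.inr hC)
    rw [mul_zero] at this
    exact tendsto_of_tendsto_of_tendsto_of_le_of_le tendsto_const_nhds this (fun _ => zero_le) hbC
  have hlim := (ENNReal.tendsto_nat_tsum a).add hb
  rw [add_zero] at hlim
  rw [expectedHittingTime_eq_tsum]
  exact tendsto_nhds_unique hlim (by simp_rw [← hsum]; exact tendsto_const_nhds)

/-! ### Reversible walks with a spectral gap: Green functions and their diagonal. -/

/-- The degree of `v` for the edge weights `A`. -/
def weightedDegree {V : Type*} [Fintype V] (A : V → V → ℝ) (v : V) : ℝ := ∑ y, A v y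

/-- The transition operator of the random walk with edge weights `A`. -/
noncomputable def walkOp {V : Type*} [Fintype V] (A : V → V → ℝ) (f : V → ℝ) (v : V) : ℝ :=
  (∑ y, A v y * f y) / weightedDegree A v

lemma degree_mul_walkOp {V : Type*} [Fintype V] {A : V → V → ℝ} {v : V}
    (hd : 0 < weightedDegree A v) (f : V → ℝ) :
    weightedDegree A v * walkOp A f v = ∑ y, A v y * f y := by
  unfold walkOp
  field_simp

lemma sum_walkOp_mul {V : Type*} [Fintype V] {A : V → V → ℝ} (hA : ∀ v w, A v w = A w v)
    (hd : ∀ v, 0 < weightedDegree A v) (f g : V → ℝ) :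
    ∑ v, weightedDegree A v * walkOp A f v * g v = ∑ v, weightedDegree A v * f v * walkOp A g v := by
  have e1 : ∀ v, weightedDegree A v * walkOp A f v * g v = ∑ y, A v y * f y * g v := fun v => by
    rw [degree_mul_walkOp (hd v), Finset.sum_mul]
  have e2 : ∀ v, weightedDegree A v * f v * walkOp A g v = ∑ y, A v y * f v * g y := fun v => by
    rw [mul_right_comm, degree_mul_walkOp (hd v), Finset.sum_mul]
    exact Finset.sum_congr rfl fun y _ => by ring
  simp_rw [e1, e2]
  rw [Finset.sum_comm]
  exact Finset.sum_congr rfl fun v _ => Finset.sum_congr rfl fun y _ => by rw [hA]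

lemma sum_degree_mul_walkOp {V : Type*} [Fintype V] {A : V → V → ℝ} (hA : ∀ v w, A v w = A w v)
    (hd : ∀ v, 0 < weightedDegree A v) (f : V → ℝ) :
    ∑ v, weightedDegree A v * walkOp A f v = ∑ v, weightedDegree A v * f v := by
  have h := sum_walkOp_mul hA hd f (fun _ => 1)
  have h1 : ∀ v, walkOp A (fun _ => 1) v = 1 := fun v => by
    simp only [walkOp, mul_one]
    exact div_self (hd v).ne'
  simpa [h1] using h

/-- The spectral gap inequality for the weights `A`, with constant `γ`. -/
def HasGap {V : Type*} [Fintype V] (A : V → V → ℝ) (γ : ℝ) : Prop :=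
  ∀ f : V → ℝ, ∑ v, weightedDegree A v * f v = 0 →
    γ * ∑ v, weightedDegree A v * f v ^ 2 ≤
      ∑ v, weightedDegree A v * f v * (f v - walkOp A f v)

lemma walkOp_sub {V : Type*} [Fintype V] (A : V → V → ℝ) (f g : V → ℝ) (v : V) :
    walkOp A (fun u => f u - g u) v = walkOp A f v - walkOp A g v := by
  simp only [walkOp, ← sub_div, ← Finset.sum_sub_distrib, mul_sub]

/-- Writing `P` for `walkOp A`, `⟨g, φ⟩ = ⟨φ, φ⟩ + ⟨φ, Pφ⟩ + ⟨Pg, Pφ⟩`. Only the last term is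
estimated by the gap, so the loss `γ⁻¹` falls on `‖Pφ‖²`, which is much smaller than `‖φ‖²` when `φ`
is a centred point mass and degrees are large. -/
lemma sum_green_le {V : Type*} [Fintype V] {A : V → V → ℝ} (hA : ∀ v w, A v w = A w v)
    (hd : ∀ v, 0 < weightedDegree A v) {γ : ℝ} (hγ : 0 < γ) (hgap : HasGap A γ) {g φ : V → ℝ}
    (hg : ∀ v, g v - walkOp A g v = φ v) (hg0 : ∑ v, weightedDegree A v * g v = 0) :
    ∑ v, weightedDegree A v * g v * φ v ≤ ∑ v, weightedDegree A v * φ v ^ 2 +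
      ∑ v, weightedDegree A v * φ v * walkOp A φ v +
      γ⁻¹ * ∑ v, weightedDegree A v * walkOp A φ v ^ 2 := by
  set k := walkOp A g
  set u := walkOp A φ
  have hk0 : ∑ v, weightedDegree A v * k v = 0 := by rw [sum_degree_mul_walkOp hA hd, hg0]
  have hku : ∀ v, k v - walkOp A k v = u v := fun v => by
    have : φ = fun v => g v - k v := by ext v; exact (hg v).symm
    simp only [u, this, walkOp_sub]
    rfl
  have h1 := hgap k hk0
  simp_rw [hku] at h1
  -- Young's inequality `2⟨k, u⟩ ≤ γ‖k‖² + γ⁻¹‖u‖²`; as `(I - P) k = u`, the gap gives `γ‖k‖² ≤ ⟨k,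
  -- u⟩`, so one copy of `⟨k, u⟩` is absorbed.
  have h2 : 0 ≤ ∑ v, weightedDegree A v * (γ * k v ^ 2 - 2 * (k v * u v) + γ⁻¹ * u v ^ 2) := by
    refine Finset.sum_nonneg fun v _ => mul_nonneg (hd v).le ?_
    have : γ * k v ^ 2 - 2 * (k v * u v) + γ⁻¹ * u v ^ 2 = γ⁻¹ * (γ * k v - u v) ^ 2 := by
      field_simp; ring
    rw [this]; positivity
  have h3 : ∑ v, weightedDegree A v * (γ * k v ^ 2 - 2 * (k v * u v) + γ⁻¹ * u v ^ 2) =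
      γ * ∑ v, weightedDegree A v * k v ^ 2 - 2 * ∑ v, weightedDegree A v * k v * u v +
      γ⁻¹ * ∑ v, weightedDegree A v * u v ^ 2 := by
    simp only [Finset.mul_sum, ← Finset.sum_sub_distrib, ← Finset.sum_add_distrib]
    exact Finset.sum_congr rfl fun v _ => by ring
  have h4 : ∑ v, weightedDegree A v * g v * φ v = ∑ v, weightedDegree A v * φ v ^ 2 +
      ∑ v, weightedDegree A v * k v * φ v := by
    rw [← Finset.sum_add_distrib]
    exact Finset.sum_congr rfl fun v _ => by rw [← hg v]; ring
  have h5 : ∑ v, weightedDegree A v * k v * φ v = ∑ v, weightedDegree A v * φ v * u v +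
      ∑ v, weightedDegree A v * k v * u v := by
    rw [sum_walkOp_mul hA hd, ← Finset.sum_add_distrib]
    exact Finset.sum_congr rfl fun v _ => by rw [← hg v]; ring
  linarith

lemma HasGap.nonneg {V : Type*} [Fintype V] {A : V → V → ℝ}
    (hd : ∀ v, 0 < weightedDegree A v) {γ : ℝ} (hγ : 0 < γ) (hgap : HasGap A γ) {f : V → ℝ}
    (hf : ∑ v, weightedDegree A v * f v = 0) :
    0 ≤ ∑ v, weightedDegree A v * f v * (f v - walkOp A f v) :=
  le_trans (mul_nonneg hγ.le (Finset.sum_nonneg fun v _ => mul_nonneg (hd v).le (sq_nonneg _)))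
    (hgap f hf)

/-- The difference of the two sides is the energy of `g - φ = Pg`, which is nonnegative. -/
lemma le_sum_green {V : Type*} [Fintype V] {A : V → V → ℝ} (hA : ∀ v w, A v w = A w v)
    (hd : ∀ v, 0 < weightedDegree A v) {γ : ℝ} (hγ : 0 < γ) (hgap : HasGap A γ) {g φ : V → ℝ}
    (hg : ∀ v, g v - walkOp A g v = φ v) (hg0 : ∑ v, weightedDegree A v * g v = 0)
    (hφ0 : ∑ v, weightedDegree A v * φ v = 0) :
    ∑ v, weightedDegree A v * φ v ^ 2 + ∑ v, weightedDegree A v * φ v * walkOp A φ v ≤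
      ∑ v, weightedDegree A v * g v * φ v := by
  have h1 := hgap.nonneg hd hγ (f := fun v => g v - φ v) (by
    simp only [mul_sub, Finset.sum_sub_distrib, hg0, hφ0, sub_zero])
  simp only [walkOp_sub] at h1
  have h2 : ∑ v, weightedDegree A v * (g v - φ v) *
      (g v - φ v - (walkOp A g v - walkOp A φ v)) =
      ∑ v, weightedDegree A v * g v * walkOp A φ v
      - ∑ v, weightedDegree A v * φ v * walkOp A φ v := by
    rw [← Finset.sum_sub_distrib]
    refine Finset.sum_congr rfl fun v _ => ?_
    have : walkOp A g v = g v - φ v := by rw [← hg v]; ring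
    rw [this]; ring
  have h3 : ∑ v, weightedDegree A v * g v * walkOp A φ v =
      ∑ v, weightedDegree A v * g v * φ v - ∑ v, weightedDegree A v * φ v ^ 2 := by
    rw [← sum_walkOp_mul hA hd, ← Finset.sum_sub_distrib]
    refine Finset.sum_congr rfl fun v _ => ?_
    have : walkOp A g v = g v - φ v := by rw [← hg v]; ring
    rw [this]; ring
  linarith

lemma HasGap.eq_zero {V : Type*} [Fintype V] {A : V → V → ℝ}
    (hd : ∀ v, 0 < weightedDegree A v) {γ : ℝ} (hγ : 0 < γ) (hgap : HasGap A γ) {f : V → ℝ}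
    (hf : ∑ v, weightedDegree A v * f v = 0) (hharm : ∀ v, walkOp A f v = f v) : f = 0 := by
  have h1 := hgap f hf
  simp only [hharm, sub_self, mul_zero, Finset.sum_const_zero] at h1
  have h2 : ∑ v, weightedDegree A v * f v ^ 2 ≤ 0 := nonpos_of_mul_nonpos_right h1 hγ
  have h3 := (Finset.sum_eq_zero_iff_of_nonneg
    fun v _ => mul_nonneg (hd v).le (sq_nonneg (f v))).1
    (le_antisymm h2 (Finset.sum_nonneg fun v _ => mul_nonneg (hd v).le (sq_nonneg (f v))))
  ext v
  have := h3 v (Finset.mem_univ v)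
  simpa [(hd v).ne'] using this

lemma exists_green {V : Type*} [Fintype V] {A : V → V → ℝ} (hA : ∀ v w, A v w = A w v)
    (hd : ∀ v, 0 < weightedDegree A v) {γ : ℝ} (hγ : 0 < γ) (hgap : HasGap A γ) (φ : V → ℝ)
    (hφ : ∑ v, weightedDegree A v * φ v = 0) :
    ∃ g : V → ℝ, ∑ v, weightedDegree A v * g v = 0 ∧ ∀ v, g v - walkOp A g v = φ v := by
  rcases isEmpty_or_nonempty V with hV | hV
  · exact ⟨0, by simp, fun v => hV.elim v⟩
  have hW : 0 < ∑ v, weightedDegree A v :=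
    Finset.sum_pos (fun v _ => hd v) Finset.univ_nonempty
  -- `I - P` kills constants. Adding the rank-one map onto constants makes it injective, hence
  -- surjective in finite dimension, and the added term vanishes on solutions with centred
  -- right-hand side.
  let T : (V → ℝ) →ₗ[ℝ] (V → ℝ) :=
    { toFun := fun f v => f v - walkOp A f v + ∑ u, weightedDegree A u * f u
      map_add' := fun f g => by
        ext v
        simp only [walkOp, Pi.add_apply, mul_add, Finset.sum_add_distrib, add_div]
        ring
      map_smul' := fun c f => by
        ext v
        have : ∀ B : V → ℝ, ∑ u, B u * (c * f u) = c * ∑ u, B u * f u := fun B => by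
          rw [Finset.mul_sum]; exact Finset.sum_congr rfl fun _ _ => by ring
        simp only [walkOp, Pi.smul_apply, smul_eq_mul, this, RingHom.id_apply]
        ring }
  have hT : ∀ f v, T f v = f v - walkOp A f v + ∑ u, weightedDegree A u * f u := fun _ _ => rfl
  have hsum : ∀ f, ∑ v, weightedDegree A v * T f v =
      (∑ v, weightedDegree A v) * ∑ u, weightedDegree A u * f u := fun f => by
    simp only [hT, mul_add, mul_sub, Finset.sum_add_distrib, Finset.sum_sub_distrib,
      sum_degree_mul_walkOp hA hd, Finset.sum_mul, sub_self, zero_add]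
  have hinj : Function.Injective T := by
    rw [injective_iff_map_eq_zero]
    intro f hf
    have h0 : ∑ u, weightedDegree A u * f u = 0 := by
      have := hsum f
      simp only [hf, Pi.zero_apply, mul_zero, Finset.sum_const_zero] at this
      exact (mul_eq_zero.1 this.symm).resolve_left hW.ne'
    refine hgap.eq_zero hd hγ h0 fun v => ?_
    have := congrFun hf v
    rw [hT, h0] at this
    simp at this
    linarith
  obtain ⟨g, hg⟩ := (LinearMap.injective_iff_surjective.1 hinj) φ
  have h0 : ∑ u, weightedDegree A u * g u = 0 := by
    have := hsum g
    rw [hg, hφ] at this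
    exact (mul_eq_zero.1 this.symm).resolve_left hW.ne'
  refine ⟨g, h0, fun v => ?_⟩
  have := congrFun hg v
  rw [hT, h0, add_zero] at this
  exact this

/-! ### Random target lemma with quantitative bounds. -/

/-- **Random target lemma** with bounds: the hitting times of the walk with edge weights `A`,
given here as solutions of the one-step equations, have a target average that does not depend on
the starting point and is controlled by the spectral gap and the smallest degree. -/
theorem exists_hitting_of_hasGap {V : Type*} [Fintype V] [DecidableEq V] {A : V → V → ℝ}
    (hA : ∀ v w, A v w = A w v) (hA0 : ∀ v w, 0 ≤ A v w) (hA1 : ∀ v w, A v w ≤ 1)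
    {δ : ℝ} (hδ : 0 < δ) (hd : ∀ v, δ ≤ weightedDegree A v)
    {γ : ℝ} (hγ : 0 < γ) (hgap : HasGap A γ) :
    ∃ h : V → V → ℝ, (∀ w, h w w = 0) ∧ (∀ w v, v ≠ w → h w v = 1 + walkOp A (h w) v) ∧
      ∀ v, (Fintype.card V : ℝ) - 2 ≤
          ∑ w, weightedDegree A w / (∑ u, weightedDegree A u) * h w v ∧
        ∑ w, weightedDegree A w / (∑ u, weightedDegree A u) * h w v ≤
          Fintype.card V * (1 + δ⁻¹ + γ⁻¹ * δ⁻¹) := by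
  rcases isEmpty_or_nonempty V with hV | hV
  · exact ⟨fun _ _ => 0, fun _ => rfl, fun w => hV.elim w, fun w => hV.elim w⟩
  have hd0 : ∀ v, 0 < weightedDegree A v := fun v => hδ.trans_le (hd v)
  set W := ∑ u, weightedDegree A u with hWdef
  have hW : 0 < W := Finset.sum_pos (fun v _ => hd0 v) Finset.univ_nonempty
  -- The point mass at `w` divided by the invariant distribution, centred.
  let φ : V → V → ℝ := fun w v => (if v = w then W / weightedDegree A w else 0) - 1
  have hφ0 : ∀ w, ∑ v, weightedDegree A v * φ w v = 0 := fun w => by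
    simp only [φ, mul_sub, Finset.sum_sub_distrib, mul_ite, mul_zero, Finset.sum_ite_eq',
      Finset.mem_univ, if_true, mul_one]
    rw [mul_div_cancel₀ _ (hd0 w).ne']
    simp [hWdef]
  choose g hg0 hg using fun w => exists_green hA hd0 hγ hgap (φ w) (hφ0 w)
  -- This sum is centred and, since `∑ w, weightedDegree A w * φ w v = 0`, harmonic. Its vanishing
  -- makes the target average independent of the starting point.
  have hk : (fun v => ∑ w, weightedDegree A w * g w v) = 0 := by
    refine hgap.eq_zero hd0 hγ ?_ fun v => ?_
    · simp only [Finset.mul_sum]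
      rw [Finset.sum_comm]
      refine Finset.sum_eq_zero fun w _ => ?_
      rw [← mul_zero (weightedDegree A w), ← hg0 w, Finset.mul_sum]
      exact Finset.sum_congr rfl fun v _ => by ring
    · have e1 : walkOp A (fun v => ∑ w, weightedDegree A w * g w v) v =
          ∑ w, weightedDegree A w * walkOp A (g w) v := by
        simp only [walkOp, Finset.mul_sum, Finset.sum_div, mul_div_assoc']
        rw [Finset.sum_comm]
        exact Finset.sum_congr rfl fun v _ => Finset.sum_congr rfl fun y _ => by ring
      have e2 : ∀ w, walkOp A (g w) v = g w v - φ w v := fun w => by rw [← hg w v]; ring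
      rw [e1]
      simp only [e2, mul_sub, Finset.sum_sub_distrib]
      have e3 : ∑ w, weightedDegree A w * φ w v = 0 := by
        simp only [φ, mul_sub, Finset.sum_sub_distrib, mul_ite, mul_zero, Finset.sum_ite_eq,
          Finset.mem_univ, if_true, mul_one]
        rw [mul_div_cancel₀ _ (hd0 v).ne']
        simp [hWdef]
      linarith
  have hgg : ∀ w, ∑ v, weightedDegree A v * g w v * φ w v = W * g w w := fun w => by
    simp only [φ, mul_sub, Finset.sum_sub_distrib, mul_ite, mul_zero, Finset.sum_ite_eq',
      Finset.mem_univ, if_true, mul_one, hg0]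
    field_simp [(hd0 w).ne']
    ring
  have hPφ : ∀ w v, walkOp A (φ w) v = W * A v w / (weightedDegree A v * weightedDegree A w) - 1 := by
    intro w v
    simp only [walkOp, φ, mul_sub, Finset.sum_sub_distrib, mul_ite, mul_zero, Finset.sum_ite_eq',
      Finset.mem_univ, if_true, mul_one, sub_div]
    have : (∑ y, A v y) / weightedDegree A v = 1 := div_self (hd0 v).ne'
    rw [this]
    field_simp [(hd0 w).ne', (hd0 v).ne']
  have hφφ : ∀ w, ∑ v, weightedDegree A v * φ w v ^ 2 = W ^ 2 / weightedDegree A w - W := fun w => by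
    have : ∀ v, weightedDegree A v * φ w v ^ 2 =
        (if v = w then W ^ 2 / weightedDegree A w - 2 * W else 0) + weightedDegree A v := by
      intro v
      by_cases hv : v = w
      · subst hv
        simp only [φ, if_true]
        field_simp [(hd0 v).ne']
        ring
      · simp [φ, hv]
    simp only [this, Finset.sum_add_distrib, Finset.sum_ite_eq', Finset.mem_univ, if_true]
    rw [← hWdef]; ring
  have hφP : ∀ w, ∑ v, weightedDegree A v * φ w v * walkOp A (φ w) v =
      W * walkOp A (φ w) w := fun w => by
    have h0 : ∑ v, weightedDegree A v * walkOp A (φ w) v = 0 := by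
      rw [sum_degree_mul_walkOp hA hd0, hφ0]
    have : ∀ v, weightedDegree A v * φ w v * walkOp A (φ w) v =
        (if v = w then W * walkOp A (φ w) w else 0) - weightedDegree A v * walkOp A (φ w) v := by
      intro v
      by_cases hv : v = w
      · subst hv
        simp only [φ, if_true]
        field_simp [(hd0 v).ne']
      · simp [φ, hv]
    simp only [this, Finset.sum_sub_distrib, Finset.sum_ite_eq', Finset.mem_univ, if_true, h0,
      sub_zero]
  -- Up to normalization this is a two-step return probability. It is bounded through `A v w ^ 2 ≤ A
  -- v w` and `δ ≤ weightedDegree A v`; the cross term sums to zero.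
  have hPP : ∀ w, ∑ v, weightedDegree A v * walkOp A (φ w) v ^ 2 ≤ W ^ 2 / (weightedDegree A w * δ) := by
    intro w
    have hdw := hd0 w
    have h0 : ∑ v, weightedDegree A v * walkOp A (φ w) v = 0 := by
      rw [sum_degree_mul_walkOp hA hd0, hφ0]
    have h1 : ∀ v, weightedDegree A v * walkOp A (φ w) v ^ 2 ≤
        W ^ 2 / (weightedDegree A w ^ 2 * δ) * A w v - 2 * (weightedDegree A v * walkOp A (φ w) v)
          - weightedDegree A v := by
      intro v
      have hdv := hd0 v
      have e : weightedDegree A v * walkOp A (φ w) v ^ 2 =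
        W ^ 2 * A v w ^ 2 / (weightedDegree A v * weightedDegree A w ^ 2)
          - 2 * (weightedDegree A v * walkOp A (φ w) v) - weightedDegree A v := by
        rw [hPφ]
        field_simp
        ring
      rw [e]
      have : W ^ 2 * A v w ^ 2 / (weightedDegree A v * weightedDegree A w ^ 2) ≤
          W ^ 2 / (weightedDegree A w ^ 2 * δ) * A w v := by
        rw [hA w v, div_mul_eq_mul_div, mul_comm (weightedDegree A w ^ 2) δ]
        have : A v w ^ 2 ≤ A v w := by nlinarith [hA0 v w, hA1 v w]
        have h2 := hA0 v w
        have h3 := hd v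
        gcongr
      linarith
    refine (Finset.sum_le_sum fun v _ => h1 v).trans ?_
    rw [Finset.sum_sub_distrib, Finset.sum_sub_distrib, ← Finset.mul_sum, ← Finset.mul_sum, h0,
      ← hWdef]
    change W ^ 2 / (weightedDegree A w ^ 2 * δ) * weightedDegree A w - 2 * 0 - W ≤ _
    have : W ^ 2 / (weightedDegree A w ^ 2 * δ) * weightedDegree A w =
      W ^ 2 / (weightedDegree A w * δ) := by field_simp
    linarith
  have hupper : ∀ w, weightedDegree A w / W * g w w ≤ 1 + δ⁻¹ + γ⁻¹ * δ⁻¹ := by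
    intro w
    have hdw := hd0 w
    have h1 := sum_green_le hA hd0 hγ hgap (hg w) (hg0 w)
    rw [hgg, hφφ, hφP, hPφ] at h1
    have h2 := mul_le_mul_of_nonneg_left (hPP w) (inv_nonneg.2 hγ.le)
    have h3 : weightedDegree A w / W * g w w = weightedDegree A w / W ^ 2 * (W * g w w) := by
      field_simp
    rw [h3]
    calc weightedDegree A w / W ^ 2 * (W * g w w)
        ≤ weightedDegree A w / W ^ 2 * (W ^ 2 / weightedDegree A w - W +
          W * (W * A w w / (weightedDegree A w * weightedDegree A w) - 1) +
          γ⁻¹ * (W ^ 2 / (weightedDegree A w * δ))) := by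
          gcongr
          linarith
      _ = 1 + A w w / weightedDegree A w + γ⁻¹ * δ⁻¹ - 2 * (weightedDegree A w / W) := by
          field_simp
          ring
      _ ≤ 1 + δ⁻¹ + γ⁻¹ * δ⁻¹ := by
          have h4 : 0 ≤ weightedDegree A w / W := by positivity
          have h5 : A w w / weightedDegree A w ≤ δ⁻¹ := by
            rw [← one_div]
            exact div_le_div₀ zero_le_one (hA1 w w) hδ (hd w)
          linarith
  have hlower : ∀ w, 1 - 2 * (weightedDegree A w / W) ≤ weightedDegree A w / W * g w w := by
    intro w
    have hdw := hd0 w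
    have h1 := le_sum_green hA hd0 hγ hgap (hg w) (hg0 w) (hφ0 w)
    rw [hgg, hφφ, hφP, hPφ] at h1
    have h3 : weightedDegree A w / W * g w w = weightedDegree A w / W ^ 2 * (W * g w w) := by
      field_simp
    rw [h3]
    calc 1 - 2 * (weightedDegree A w / W)
        ≤ 1 + A w w / weightedDegree A w - 2 * (weightedDegree A w / W) := by
          have := div_nonneg (hA0 w w) hdw.le
          linarith
      _ = weightedDegree A w / W ^ 2 * (W ^ 2 / weightedDegree A w - W +
          W * (W * A w w / (weightedDegree A w * weightedDegree A w) - 1)) := by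
          field_simp
          ring
      _ ≤ _ := by gcongr
  -- Away from `w` the right-hand side `φ w` equals `-1`, which is the one-step equation up to sign.
  refine ⟨fun w v => g w w - g w v, fun w => sub_self _, fun w v hv => ?_, fun v => ?_⟩
  · rw [walkOp_sub]
    have h1 := hg w v
    simp only [φ, if_neg hv] at h1
    have h2 : walkOp A (fun _ => g w w) v = g w w := by
      simp only [walkOp, ← Finset.sum_mul]
      exact mul_div_cancel_left₀ _ (hd0 v).ne'
    rw [h2]; linarith
  · have e : ∑ w, weightedDegree A w / W * (g w w - g w v) =
        ∑ w, weightedDegree A w / W * g w w := by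
      have : ∑ w, weightedDegree A w / W * g w v = 0 := by
        have := congrFun hk v
        simp only [Pi.zero_apply] at this
        rw [← zero_div W, ← this, Finset.sum_div]
        exact Finset.sum_congr rfl fun w _ => by ring
      simp only [mul_sub, Finset.sum_sub_distrib, this, sub_zero]
    rw [e]
    constructor
    · refine le_trans (le_of_eq ?_) (Finset.sum_le_sum fun w _ => hlower w)
      rw [Finset.sum_sub_distrib, ← Finset.mul_sum, ← Finset.sum_div, ← hWdef, div_self hW.ne']
      simp
    · refine (Finset.sum_le_sum fun w _ => hupper w).trans (le_of_eq ?_)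
      rw [Finset.sum_const, Finset.card_univ, nsmul_eq_mul]

/-! ### Cheeger's inequality from a lower bound on cut densities. -/

/-- Coarea: a sum `∑ c v w * |g v - g w|` is nonnegative for all `g` if it is so for indicators. -/
lemma sum_mul_abs_sub_nonneg {V : Type*} [Fintype V] (c : V → V → ℝ)
    (hc : ∀ S : V → Prop, 0 ≤ ∑ v, ∑ w, c v w * (open Classical in if (S v ↔ S w) then 0 else 1))
    (g : V → ℝ) : 0 ≤ ∑ v, ∑ w, c v w * |g v - g w| := by
  classical
  have hint : ∀ v w, Integrable ((Set.uIoc (g v) (g w)).indicator (fun _ => (1 : ℝ))) := fun v w =>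
    (integrable_indicator_iff measurableSet_uIoc).2 (by
      simp [integrableOn_const_iff, Set.uIoc, Real.volume_Ioc])
  have habs : ∀ v w, |g v - g w| = ∫ t, (Set.uIoc (g v) (g w)).indicator (fun _ => (1 : ℝ)) t := by
    intro v w
    rw [integral_indicator_const _ measurableSet_uIoc, smul_eq_mul, mul_one, measureReal_def,
      Real.volume_uIoc, ENNReal.toReal_ofReal (abs_nonneg _), abs_sub_comm]
  have hint2 : ∀ v w, Integrable
      (fun t => c v w * (Set.uIoc (g v) (g w)).indicator (fun _ => (1 : ℝ)) t) := fun v w =>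
    (hint v w).const_mul _
  have e : ∑ v, ∑ w, c v w * |g v - g w| =
      ∫ t, ∑ v, ∑ w, c v w * (Set.uIoc (g v) (g w)).indicator (fun _ => (1 : ℝ)) t := by
    rw [integral_finsetSum _ fun v _ => integrable_finsetSum _ fun w _ => hint2 v w]
    refine Finset.sum_congr rfl fun v _ => ?_
    rw [integral_finsetSum _ fun w _ => hint2 v w]
    exact Finset.sum_congr rfl fun w _ => by rw [integral_const_mul, habs]
  rw [e]
  -- At level `t` the cut is that of the superlevel set `{t ≤ g}`: `t` lies in the half-open
  -- interval between `g v` and `g w` exactly when one of the two vertices belongs to it.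
  refine integral_nonneg fun t => (hc fun v => t ≤ g v).trans (le_of_eq ?_)
  refine Finset.sum_congr rfl fun v _ => Finset.sum_congr rfl fun w _ => ?_
  congr 1
  rw [Set.indicator_apply, Set.mem_uIoc]
  by_cases h1 : t ≤ g v <;> by_cases h2 : t ≤ g w <;> simp [h1, h2, not_lt.2, lt_of_not_ge]

/-- Coarea is applied to the signed square `f * |f|`. This bound and the next compare its increments
with those of `f`, without splitting `f` at a median. -/
lemma half_sq_sub_le_abs (a b : ℝ) : (a - b) ^ 2 / 2 ≤ |a * (|a|) - b * (|b|)| := by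
  rcases le_total 0 a with ha | ha <;> rcases le_total 0 b with hb | hb <;>
    simp only [abs_of_nonneg, abs_of_nonpos, ha, hb]
  · rcases le_total a b with h | h
    · rw [abs_of_nonpos] <;> nlinarith [mul_nonneg ha hb]
    · rw [abs_of_nonneg] <;> nlinarith [mul_nonneg ha hb]
  · rw [abs_of_nonneg] <;> nlinarith [sq_nonneg (a + b)]
  · rw [abs_of_nonpos] <;> nlinarith [sq_nonneg (a + b)]
  · rcases le_total a b with h | h
    · rw [abs_of_nonpos] <;> nlinarith [mul_nonneg_of_nonpos_of_nonpos ha hb]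
    · rw [abs_of_nonneg] <;> nlinarith [mul_nonneg_of_nonpos_of_nonpos ha hb]

lemma abs_mul_abs_sub_le (a b : ℝ) : |a * (|a|) - b * (|b|)| ≤ |a - b| * (|a| + |b|) := by
  rcases le_total 0 a with ha | ha <;> rcases le_total 0 b with hb | hb
  · rw [abs_of_nonneg ha, abs_of_nonneg hb, show a * a - b * b = (a - b) * (a + b) by ring, abs_mul,
      abs_of_nonneg (add_nonneg ha hb)]
  · rw [abs_of_nonneg ha, abs_of_nonpos hb, abs_of_nonneg, abs_of_nonneg (a := a - b)] <;> nlinarith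
  · rw [abs_of_nonpos ha, abs_of_nonneg hb, abs_of_nonpos, abs_of_nonpos (a := a - b)] <;> nlinarith
  · rw [abs_of_nonpos ha, abs_of_nonpos hb, show a * -a - b * -b = (a - b) * (-a + -b) by ring,
      abs_mul, abs_of_nonneg (a := -a + -b) (by linarith)]

/-- **Cheeger's inequality** for the energy form with weights `A`. -/
lemma sum_sq_le_energy {V : Type*} [Fintype V] {A : V → V → ℝ}
    (hA : ∀ v w, A v w = A w v) (hA0 : ∀ v w, 0 ≤ A v w) {D ρ : ℝ}
    (hD : ∀ v, weightedDegree A v ≤ D) (hρ : 0 ≤ ρ)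
    (hcut : ∀ S : V → Prop, 0 ≤ ∑ v, ∑ w, (A v w - ρ) *
      (open Classical in if (S v ↔ S w) then 0 else 1))
    (f : V → ℝ) (hf : ∑ v, f v = 0) :
    (ρ * Fintype.card V) ^ 2 * ∑ v, f v ^ 2 ≤ 4 * D * ∑ v, ∑ w, A v w * (f v - f w) ^ 2 := by
  set n : ℝ := (Fintype.card V : ℝ)
  set F := ∑ v, f v ^ 2
  set E := ∑ v, ∑ w, A v w * (f v - f w) ^ 2
  have hE : 0 ≤ E := Finset.sum_nonneg fun v _ => Finset.sum_nonneg fun w _ =>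
    mul_nonneg (hA0 v w) (sq_nonneg _)
  have hF : 0 ≤ F := Finset.sum_nonneg fun v _ => sq_nonneg _
  have hpair : ∑ v, ∑ w, (f v - f w) ^ 2 / 2 = n * F := by
    have : ∀ v w, (f v - f w) ^ 2 / 2 = f v ^ 2 / 2 + f w ^ 2 / 2 - f v * f w := fun v w => by ring
    simp only [this, Finset.sum_sub_distrib, Finset.sum_add_distrib, ← Finset.mul_sum, hf,
      Finset.sum_const, Finset.card_univ, nsmul_eq_mul, ← Finset.sum_div, mul_zero, sub_zero]
    ring
  -- The weights `A` dominate the complete graph of weight `ρ` on every cut, hence on total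
  -- variations.
  have h1 := sum_mul_abs_sub_nonneg (fun v w => A v w - ρ) hcut (fun v => f v * |f v|)
  have h2 : ρ * (n * F) ≤ ∑ v, ∑ w, A v w * (|f v - f w| * (|f v| + |f w|)) := by
    have h3 : ∑ v, ∑ w, ρ * ((f v - f w) ^ 2 / 2) ≤ ∑ v, ∑ w, ρ * |f v * (|f v|) - f w * (|f w|)| :=
      Finset.sum_le_sum fun v _ => Finset.sum_le_sum fun w _ =>
        mul_le_mul_of_nonneg_left (half_sq_sub_le_abs _ _) hρ
    have h4 : ∑ v, ∑ w, A v w * |f v * (|f v|) - f w * (|f w|)| ≤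
        ∑ v, ∑ w, A v w * (|f v - f w| * (|f v| + |f w|)) :=
      Finset.sum_le_sum fun v _ => Finset.sum_le_sum fun w _ =>
        mul_le_mul_of_nonneg_left (abs_mul_abs_sub_le _ _) (hA0 v w)
    simp only [sub_mul, Finset.sum_sub_distrib] at h1
    simp only [← Finset.mul_sum] at h3
    rw [hpair] at h3
    simp only [← Finset.mul_sum] at h1
    linarith
  have hCS : (∑ v, ∑ w, A v w * (|f v - f w| * (|f v| + |f w|))) ^ 2 ≤
      E * ∑ v, ∑ w, A v w * (|f v| + |f w|) ^ 2 := by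
    have := Finset.sum_mul_sq_le_sq_mul_sq (Finset.univ : Finset (V × V))
      (fun z => √(A z.1 z.2) * |f z.1 - f z.2|) (fun z => √(A z.1 z.2) * (|f z.1| + |f z.2|))
    simp only [mul_pow, Real.sq_sqrt (hA0 _ _), sq_abs] at this
    simp only [Fintype.sum_prod_type] at this
    refine le_trans (le_of_eq ?_) this
    congr 1
    refine Finset.sum_congr rfl fun v _ => Finset.sum_congr rfl fun w _ => ?_
    rw [mul_mul_mul_comm, Real.mul_self_sqrt (hA0 _ _)]
  have hdeg : ∑ v, ∑ w, A v w * (|f v| + |f w|) ^ 2 ≤ 4 * (D * F) := by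
    have h3 : ∀ v w, A v w * (|f v| + |f w|) ^ 2 ≤ 2 * (A v w * f v ^ 2) + 2 * (A w v * f w ^ 2) := by
      intro v w
      rw [hA w v]
      have : (|f v| + |f w|) ^ 2 ≤ 2 * f v ^ 2 + 2 * f w ^ 2 := by
        nlinarith [sq_abs (f v), sq_abs (f w), sq_nonneg (|f v| - |f w|)]
      nlinarith [mul_le_mul_of_nonneg_left this (hA0 v w)]
    have h4 : ∑ v, ∑ w, A v w * f v ^ 2 ≤ D * F := by
      rw [Finset.mul_sum]
      refine Finset.sum_le_sum fun v _ => ?_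
      rw [← Finset.sum_mul]
      exact mul_le_mul_of_nonneg_right (hD v) (sq_nonneg _)
    have h5 : ∑ v, ∑ w, A w v * f w ^ 2 = ∑ v, ∑ w, A v w * f v ^ 2 := Finset.sum_comm
    calc _ ≤ ∑ v, ∑ w, (2 * (A v w * f v ^ 2) + 2 * (A w v * f w ^ 2)) :=
          Finset.sum_le_sum fun v _ => Finset.sum_le_sum fun w _ => h3 v w
      _ = 2 * ∑ v, ∑ w, A v w * f v ^ 2 + 2 * ∑ v, ∑ w, A w v * f w ^ 2 := by
          simp only [Finset.sum_add_distrib, ← Finset.mul_sum]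
      _ ≤ 4 * (D * F) := by rw [h5]; linarith
  rcases hF.eq_or_lt with h0 | hFpos
  · rw [← h0, mul_zero]
    rcases isEmpty_or_nonempty V with hV | ⟨⟨v⟩⟩
    · simp [E]
    · have : 0 ≤ D := le_trans (Finset.sum_nonneg fun w _ => hA0 v w) (hD v)
      positivity
  · have h6 : (ρ * (n * F)) ^ 2 ≤ E * (4 * (D * F)) :=
      (pow_le_pow_left₀ (by positivity) h2 2).trans
        (hCS.trans (mul_le_mul_of_nonneg_left hdeg hE))
    have h7 : ((ρ * n) ^ 2 * F) * F ≤ (4 * D * E) * F := by nlinarith [h6]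
    exact le_of_mul_le_mul_right h7 hFpos

/-- Cheeger's bound concerns functions centred for the counting measure, the gap those centred for
the degrees. Recentring a degree-centred `f` by its plain mean can only increase its degree-weighted
norm. -/
theorem hasGap_of_cut {V : Type*} [Fintype V] {A : V → V → ℝ}
    (hA : ∀ v w, A v w = A w v) (hA0 : ∀ v w, 0 ≤ A v w) {D ρ : ℝ} (hD0 : 0 < D)
    (hd : ∀ v, 0 < weightedDegree A v) (hD : ∀ v, weightedDegree A v ≤ D) (hρ : 0 ≤ ρ)
    (hcut : ∀ S : V → Prop, 0 ≤ ∑ v, ∑ w, (A v w - ρ) *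
      (open Classical in if (S v ↔ S w) then 0 else 1)) :
    HasGap A ((ρ * Fintype.card V) ^ 2 / (8 * D ^ 2)) := by
  intro f hf
  rcases isEmpty_or_nonempty V with hV | hV
  · simp
  set n : ℝ := (Fintype.card V : ℝ)
  have hn : 0 < n := by simp only [n]; exact_mod_cast Fintype.card_pos
  set m := (∑ v, f v) / n
  have hE : ∑ v, weightedDegree A v * f v * (f v - walkOp A f v) =
      (∑ v, ∑ w, A v w * (f v - f w) ^ 2) / 2 := by
    have h1 : ∀ v, weightedDegree A v * f v * (f v - walkOp A f v) =
        ∑ w, A v w * (f v ^ 2 - f v * f w) := fun v => by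
      have : weightedDegree A v * f v * (f v - walkOp A f v) =
        weightedDegree A v * f v ^ 2 - f v * (weightedDegree A v * walkOp A f v) := by ring
      rw [this, degree_mul_walkOp (hd v), weightedDegree, Finset.sum_mul, Finset.mul_sum,
        ← Finset.sum_sub_distrib]
      exact Finset.sum_congr rfl fun w _ => by ring
    have h2 : ∑ v, ∑ w, A v w * (f v ^ 2 - f v * f w) = ∑ v, ∑ w, A v w * (f w ^ 2 - f v * f w) := by
      rw [Finset.sum_comm]
      exact Finset.sum_congr rfl fun v _ => Finset.sum_congr rfl fun w _ => by rw [hA]; ring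
    have h3 : ∑ v, ∑ w, A v w * (f v - f w) ^ 2 = ∑ v, ∑ w, A v w * (f v ^ 2 - f v * f w) +
        ∑ v, ∑ w, A v w * (f w ^ 2 - f v * f w) := by
      simp only [← Finset.sum_add_distrib]
      exact Finset.sum_congr rfl fun v _ => Finset.sum_congr rfl fun w _ => by ring
    simp only [h1]
    rw [h3, ← h2]; ring
  have hm : ∑ v, (f v - m) = 0 := by
    rw [Finset.sum_sub_distrib, Finset.sum_const, Finset.card_univ, nsmul_eq_mul]
    change _ - n * m = 0
    simp only [m]
    field_simp
    ring
  have h1 := sum_sq_le_energy hA hA0 hD hρ hcut (fun v => f v - m) hm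
  simp only [sub_sub_sub_cancel_right] at h1
  have h2 : ∑ v, weightedDegree A v * f v ^ 2 ≤ D * ∑ v, (f v - m) ^ 2 := by
    have : ∑ v, weightedDegree A v * (f v - m) ^ 2 = ∑ v, weightedDegree A v * f v ^ 2 +
        m ^ 2 * ∑ v, weightedDegree A v := by
      have : ∀ v, weightedDegree A v * (f v - m) ^ 2 = weightedDegree A v * f v ^ 2 -
        2 * m * (weightedDegree A v * f v) + m ^ 2 * weightedDegree A v := fun v => by ring
      simp only [this, Finset.sum_add_distrib, Finset.sum_sub_distrib, ← Finset.mul_sum, hf]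
      ring
    calc ∑ v, weightedDegree A v * f v ^ 2 ≤ ∑ v, weightedDegree A v * (f v - m) ^ 2 := by
          rw [this]
          have : 0 ≤ ∑ v, weightedDegree A v := Finset.sum_nonneg fun v _ => (hd v).le
          nlinarith [mul_nonneg (sq_nonneg m) this]
      _ ≤ _ := by
          rw [Finset.mul_sum]
          exact Finset.sum_le_sum fun v _ => mul_le_mul_of_nonneg_right (hD v) (sq_nonneg _)
  rw [hE]
  calc (ρ * n) ^ 2 / (8 * D ^ 2) * ∑ v, weightedDegree A v * f v ^ 2
      ≤ (ρ * n) ^ 2 / (8 * D ^ 2) * (D * ∑ v, (f v - m) ^ 2) := by gcongr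
    _ = ((ρ * n) ^ 2 * ∑ v, (f v - m) ^ 2) / (8 * D) := by field_simp
    _ ≤ (4 * D * ∑ v, ∑ w, A v w * (f v - f w) ^ 2) / (8 * D) := by gcongr
    _ = _ := by field_simp; ring

/-! ### Deterministic bounds for expanding graphs. -/

/-- The adjacency matrix of `G`. -/
def adjacency {N : ℕ} (G : EdgeConfig N) (v w : Fin N) : ℝ := if G s(v, w) = true then 1 else 0

lemma adjacency_comm {N : ℕ} (G : EdgeConfig N) (v w : Fin N) :
    adjacency G v w = adjacency G w v := by
  simp only [adjacency, Sym2.eq_swap]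

lemma adjacency_nonneg {N : ℕ} (G : EdgeConfig N) (v w : Fin N) : 0 ≤ adjacency G v w := by
  unfold adjacency; split_ifs <;> norm_num

lemma adjacency_le_one {N : ℕ} (G : EdgeConfig N) (v w : Fin N) : adjacency G v w ≤ 1 := by
  unfold adjacency; split_ifs <;> norm_num

lemma weightedDegree_adjacency {N : ℕ} (G : EdgeConfig N) (v : Fin N) :
    weightedDegree (adjacency G) v = degree G v := by
  simp [weightedDegree, adjacency, degree, neighbors]

lemma walkOp_adjacency {N : ℕ} (G : EdgeConfig N) (f : Fin N → ℝ) (v : Fin N) :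
    walkOp (adjacency G) f v = (∑ y ∈ neighbors G v, f y) / degree G v := by
  simp [walkOp, weightedDegree_adjacency, adjacency, neighbors, Finset.sum_filter]

/-- A cut is symmetric under complementation, so sets with at most half of the vertices suffice;
this matters for the union bound. -/
lemma sum_cut_nonneg {V : Type*} [Fintype V] [DecidableEq V] {c : V → V → ℝ}
    (hsymm : ∀ v w, c v w = c w v)
    (hcut : ∀ S : Finset V, 2 * S.card ≤ Fintype.card V → 0 ≤ ∑ v ∈ S, ∑ w ∈ Sᶜ, c v w)
    (S : V → Prop) :
    0 ≤ ∑ v, ∑ w, c v w * (open Classical in if (S v ↔ S w) then 0 else 1) := by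
  classical
  set T : Finset V := Finset.univ.filter S
  have hT : ∀ v, v ∈ T ↔ S v := fun v => by simp [T]
  have e : ∑ v, ∑ w, c v w * (if (S v ↔ S w) then 0 else 1) = 2 * ∑ v ∈ T, ∑ w ∈ Tᶜ, c v w := by
    have h1 : ∀ v ∈ T, ∑ w, c v w * (if (S v ↔ S w) then 0 else 1) = ∑ w ∈ Tᶜ, c v w := by
      intro v hv
      have hv' := (hT v).1 hv
      rw [← Finset.sum_add_sum_compl T, Finset.sum_eq_zero, zero_add]
      · refine Finset.sum_congr rfl fun w hw => ?_
        rw [Finset.mem_compl, hT] at hw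
        simp [hv', hw]
      · intro w hw
        simp [hv', (hT w).1 hw]
    have h2 : ∀ v ∈ Tᶜ, ∑ w, c v w * (if (S v ↔ S w) then 0 else 1) = ∑ w ∈ T, c v w := by
      intro v hv
      have hv' : ¬ S v := by simpa [hT] using hv
      rw [← Finset.sum_add_sum_compl T, Finset.sum_eq_zero (s := Tᶜ), add_zero]
      · exact Finset.sum_congr rfl fun w hw => by simp [hv', (hT w).1 hw]
      · intro w hw
        rw [Finset.mem_compl, hT] at hw
        simp [hv', hw]
    rw [← Finset.sum_add_sum_compl T, Finset.sum_congr rfl h1, Finset.sum_congr rfl h2,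
      Finset.sum_comm (s := Tᶜ), two_mul]
    congr 1
    exact Finset.sum_congr rfl fun v _ => Finset.sum_congr rfl fun w _ => hsymm _ _
  have hcard : T.card + Tᶜ.card = Fintype.card V := Finset.card_add_card_compl T
  rw [e]
  refine mul_nonneg zero_le_two ?_
  rcases le_total T.card Tᶜ.card with h | h
  · exact hcut T (by omega)
  · have := hcut Tᶜ (by omega)
    rw [compl_compl, Finset.sum_comm] at this
    exact this.trans_eq (Finset.sum_congr rfl fun v _ => Finset.sum_congr rfl fun w _ => hsymm _ _)

/-- The target-averaged hitting time of a graph with degrees in `[δ, D]` and good expansion. -/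
theorem targetAveragedHittingTime_bounds {N : ℕ} (G : EdgeConfig N) {δ D ρ : ℝ}
    (hδ : 0 < δ) (hρ : 0 < ρ)
    (hdeg : ∀ v, δ ≤ degree G v) (hdeg' : ∀ v, (degree G v : ℝ) ≤ D)
    (hcut : ∀ S : Finset (Fin N), 2 * S.card ≤ N →
      ρ * (S.card * (N - S.card)) ≤ ∑ v ∈ S, ∑ w ∈ Sᶜ, adjacency G v w) (v : Fin N) :
    targetAveragedHittingTime G v ≠ ∞ ∧
      (N : ℝ) - 2 ≤ (targetAveragedHittingTime G v).toReal ∧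
      (targetAveragedHittingTime G v).toReal ≤ N * (1 + δ⁻¹ + 8 * D ^ 2 / (ρ * N) ^ 2 * δ⁻¹) := by
  have hN : 0 < N := v.pos
  have hNR : (0 : ℝ) < N := by exact_mod_cast hN
  have hD : 0 < D := hδ.trans_le ((hdeg v).trans (hdeg' v))
  have hd0 : ∀ u, 0 < degree G u := fun u => by exact_mod_cast hδ.trans_le (hdeg u)
  have hgap : HasGap (adjacency G) ((ρ * N) ^ 2 / (8 * D ^ 2)) := by
    have := hasGap_of_cut (A := adjacency G) (D := D) (ρ := ρ) (adjacency_comm G)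
      (adjacency_nonneg G) hD (fun u => by rw [weightedDegree_adjacency]; exact_mod_cast hd0 u)
      (fun u => by rw [weightedDegree_adjacency]; exact hdeg' u) hρ.le
      (sum_cut_nonneg (fun u w => by rw [adjacency_comm]) fun S hS => by
        rw [Fintype.card_fin] at hS
        have h := hcut S hS
        have hle : S.card ≤ N := by omega
        simp only [Finset.sum_sub_distrib, Finset.sum_const, Finset.card_compl, Fintype.card_fin,
          nsmul_eq_mul, Nat.cast_sub hle]
        linarith)
    rwa [Fintype.card_fin] at this
  obtain ⟨h, hww, hstep, hbd⟩ := exists_hitting_of_hasGap (adjacency_comm G) (adjacency_nonneg G)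
    (adjacency_le_one G) hδ (fun u => by rw [weightedDegree_adjacency]; exact hdeg u)
    (by positivity) hgap
  -- Minimum principle: at a minimum other than `w` the one-step equation would give `h ≥ 1 + h`.
  have hnn : ∀ w u, 0 ≤ h w u := by
    intro w
    obtain ⟨u₀, -, hu₀⟩ := Finset.exists_min_image Finset.univ (h w) ⟨v, Finset.mem_univ v⟩
    have : 0 ≤ h w u₀ := by
      by_cases hu : u₀ = w
      · rw [hu, hww]
      · exfalso
        have h1 := hstep w u₀ hu
        have h2 : h w u₀ ≤ walkOp (adjacency G) (h w) u₀ := by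
          rw [walkOp_adjacency, le_div_iff₀ (by exact_mod_cast hd0 u₀), mul_comm]
          have := Finset.card_nsmul_le_sum (neighbors G u₀) (h w) (h w u₀)
            fun y _ => hu₀ y (Finset.mem_univ y)
          rwa [nsmul_eq_mul] at this
        linarith
    exact fun u => this.trans (hu₀ u (Finset.mem_univ u))
  have hexp : ∀ w, expectedHittingTime G v w = ENNReal.ofReal (h w v) := by
    intro w
    refine expectedHittingTime_eq_of_step G w (fun u => ENNReal.ofReal (h w u))
      (fun u => ENNReal.ofReal_ne_top) (by simp [hww]) (fun u hu => ?_) v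
    rw [lintegral_stepLaw G u (hd0 u), hstep w u hu, walkOp_adjacency,
      ENNReal.ofReal_add zero_le_one
        (div_nonneg (Finset.sum_nonneg fun y _ => hnn w y) (Nat.cast_nonneg _)),
      ENNReal.ofReal_one, ENNReal.ofReal_div_of_pos (by exact_mod_cast hd0 u),
      ENNReal.ofReal_sum_of_nonneg (fun y _ => hnn w y), ENNReal.ofReal_natCast]
  have hW : (0 : ℝ) < ∑ u, (degree G u : ℝ) :=
    Finset.sum_pos (fun u _ => by exact_mod_cast hd0 u) ⟨v, Finset.mem_univ v⟩
  have hpi : ∀ w, invariantProb G w =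
      ENNReal.ofReal (degree G w / ∑ u, (degree G u : ℝ)) := by
    intro w
    rw [ENNReal.ofReal_div_of_pos hW, ENNReal.ofReal_natCast, invariantProb,
      ENNReal.ofReal_sum_of_nonneg (fun u _ => Nat.cast_nonneg _)]
    simp
  have hH : targetAveragedHittingTime G v =
      ENNReal.ofReal (∑ w, degree G w / (∑ u, (degree G u : ℝ)) * h w v) := by
    rw [ENNReal.ofReal_sum_of_nonneg
      (fun w _ => mul_nonneg (div_nonneg (Nat.cast_nonneg _) hW.le) (hnn w v))]
    refine Finset.sum_congr rfl fun w _ => ?_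
    rw [hpi, hexp, ENNReal.ofReal_mul (div_nonneg (Nat.cast_nonneg _) hW.le)]
  have h1 := hbd v
  simp only [weightedDegree_adjacency, Fintype.card_fin, inv_div] at h1
  refine ⟨by rw [hH]; exact ENNReal.ofReal_ne_top, ?_⟩
  rw [hH, ENNReal.toReal_ofReal
    (Finset.sum_nonneg fun w _ => mul_nonneg (div_nonneg (Nat.cast_nonneg _) hW.le) (hnn w v))]
  exact h1

/-! ### Chernoff bounds for edge counts. -/

instance {N M : ℕ} (B : Fin N → Fin M) (p q : unitInterval) : IsProbabilityMeasure (law B p q) := by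
  unfold law; infer_instance

/-- The number of edges of `G` in `F`. -/
def edgeCount {N : ℕ} (F : Finset (Sym2 (Fin N))) (G : EdgeConfig N) : ℝ :=
  ∑ e ∈ F, if G e = true then 1 else 0

/-- The expected number of edges in `F`. -/
noncomputable def edgeMean {N M : ℕ} (B : Fin N → Fin M) (p q : unitInterval)
    (F : Finset (Sym2 (Fin N))) : ℝ := ∑ e ∈ F, (edgeProb B p q e : ℝ)

/-- Independence factorizes the moment generating function; each factor is bounded by `1 + x ≤ exp
x`. -/
lemma mgf_edgeCount_le {N M : ℕ} (B : Fin N → Fin M) (p q : unitInterval)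
    (F : Finset (Sym2 (Fin N))) (t : ℝ) :
    mgf (edgeCount F) (law B p q) t ≤ Real.exp ((Real.exp t - 1) * edgeMean B p q F) := by
  classical
  have h1 : ∀ G : EdgeConfig N, Real.exp (t * edgeCount F G) =
      ∏ e, (if e ∈ F then (if G e = true then Real.exp t else 1) else 1) := by
    intro G
    rw [Finset.prod_ite_mem, Finset.univ_inter, edgeCount, Finset.mul_sum, Real.exp_sum]
    refine Finset.prod_congr rfl fun e _ => ?_
    split_ifs <;> simp
  have h2 : mgf (edgeCount F) (law B p q) t = ∏ e : Sym2 (Fin N),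
      ∫ b, (if e ∈ F then (if b = true then Real.exp t else 1) else 1)
        ∂(bernoulliMeasure true false (edgeProb B p q e)) := by
    simp only [mgf, h1, law]
    exact integral_fintype_prod_eq_prod (𝕜 := ℝ) (ι := Sym2 (Fin N)) (E := fun _ => Bool)
      (μ := fun e => bernoulliMeasure true false (edgeProb B p q e))
      fun e b => (if e ∈ F then (if b = true then Real.exp t else 1) else 1)
  have h3 : ∀ e : Sym2 (Fin N),
      ∫ b, (if e ∈ F then (if b = true then Real.exp t else 1) else 1)
        ∂(bernoulliMeasure true false (edgeProb B p q e)) =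
      if e ∈ F then 1 + edgeProb B p q e * (Real.exp t - 1) else 1 := by
    intro e
    rw [integral_bernoulliMeasure]
    by_cases he : e ∈ F
    · simp [he]; ring
    · simp [he]
  rw [h2]
  simp only [h3]
  rw [Finset.prod_ite_mem, Finset.univ_inter, edgeMean, Finset.mul_sum, Real.exp_sum]
  refine Finset.prod_le_prod (fun e _ => ?_) fun e _ => ?_
  · have h4 := (edgeProb B p q e).2
    have : 0 < Real.exp t := Real.exp_pos t
    nlinarith [h4.1, h4.2, mul_nonneg h4.1 this.le]
  · rw [add_comm, mul_comm]
    exact Real.add_one_le_exp _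

lemma integrable_of_law {N M : ℕ} (B : Fin N → Fin M) (p q : unitInterval) (f : EdgeConfig N → ℝ) :
    Integrable f (law B p q) :=
  Integrable.of_finite

/-- Chernoff with `t = -1`: the exponent is `(1/2 + e⁻¹ - 1)` times the mean, and `e⁻¹ ≤ 0.4`. The
free lower bound `m` serves the union bound over cuts. -/
lemma measureReal_edgeCount_le {N M : ℕ} (B : Fin N → Fin M) (p q : unitInterval)
    (F : Finset (Sym2 (Fin N))) {m : ℝ} (hm : m ≤ edgeMean B p q F) :
    (law B p q).real {G | edgeCount F G ≤ edgeMean B p q F / 2} ≤ Real.exp (-m / 10) := by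
  have h0 : 0 ≤ edgeMean B p q F := Finset.sum_nonneg fun e _ => (edgeProb B p q e).2.1
  refine (measure_le_le_exp_mul_mgf (t := -1) _ (by norm_num) (integrable_of_law _ _ _ _)).trans ?_
  refine (mul_le_mul_of_nonneg_left (mgf_edgeCount_le B p q F (-1)) (Real.exp_pos _).le).trans ?_
  rw [← Real.exp_add]
  refine Real.exp_le_exp.2 ?_
  have h1 : Real.exp (-1) ≤ 0.4 := by
    rw [Real.exp_neg]
    have := Real.exp_one_gt_d9
    rw [inv_le_comm₀ (by positivity) (by norm_num)]
    norm_num; linarith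
  nlinarith

/-- Chernoff with `t = 1`: the exponent is `(e - 3)` times the mean. -/
lemma measureReal_edgeCount_ge {N M : ℕ} (B : Fin N → Fin M) (p q : unitInterval)
    (F : Finset (Sym2 (Fin N))) {m : ℝ} (hm : m ≤ edgeMean B p q F) :
    (law B p q).real {G | 2 * edgeMean B p q F ≤ edgeCount F G} ≤ Real.exp (-m / 10) := by
  have h0 : 0 ≤ edgeMean B p q F := Finset.sum_nonneg fun e _ => (edgeProb B p q e).2.1
  refine (measure_ge_le_exp_mul_mgf (t := 1) _ (by norm_num) (integrable_of_law _ _ _ _)).trans ?_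
  refine (mul_le_mul_of_nonneg_left (mgf_edgeCount_le B p q F 1) (Real.exp_pos _).le).trans ?_
  rw [← Real.exp_add]
  refine Real.exp_le_exp.2 ?_
  have := Real.exp_one_lt_d9
  nlinarith

/-! ### Mean degrees and cuts, and the union bound. -/

lemma edgeProb_mk {N M : ℕ} (B : Fin N → Fin M) (p q : unitInterval) (v w : Fin N) :
    edgeProb B p q s(v, w) = if B v = B w then p else q := rfl

/-- The possible edges at `v`. -/
def starEdges {N : ℕ} (v : Fin N) : Finset (Sym2 (Fin N)) := Finset.univ.image fun w => s(v, w)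

lemma sum_starEdges {N : ℕ} (v : Fin N) (f : Sym2 (Fin N) → ℝ) : ∑ e ∈ starEdges v, f e = ∑ w, f s(v, w) :=
  Finset.sum_image fun _ _ _ _ h => Sym2.congr_right.1 h

lemma edgeCount_starEdges {N : ℕ} (v : Fin N) (G : EdgeConfig N) : edgeCount (starEdges v) G = degree G v := by
  rw [edgeCount, sum_starEdges, ← weightedDegree_adjacency]
  rfl

/-- The possible edges between `S` and its complement. -/
def cutEdges {N : ℕ} (S : Finset (Fin N)) : Finset (Sym2 (Fin N)) :=
  (S ×ˢ Sᶜ).image fun z => s(z.1, z.2)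

lemma sum_cutEdges {N : ℕ} (S : Finset (Fin N)) (f : Sym2 (Fin N) → ℝ) :
    ∑ e ∈ cutEdges S, f e = ∑ v ∈ S, ∑ w ∈ Sᶜ, f s(v, w) := by
  rw [cutEdges, Finset.sum_image, Finset.sum_product]
  rintro ⟨a, b⟩ hab ⟨c, d⟩ hcd h
  simp only [Finset.coe_product, Set.mem_prod, Finset.mem_coe, Finset.mem_compl] at hab hcd
  rcases Sym2.eq_iff.1 h with ⟨h1, h2⟩ | ⟨h1, h2⟩
  · simp only at h1 h2; rw [h1, h2]
  · simp only at h1 h2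
    exact absurd (h1 ▸ hab.1) hcd.2

lemma edgeCount_cutEdges {N : ℕ} (S : Finset (Fin N)) (G : EdgeConfig N) :
    edgeCount (cutEdges S) G = ∑ v ∈ S, ∑ w ∈ Sᶜ, adjacency G v w := by
  rw [edgeCount, sum_cutEdges]
  rfl

/-- The expected degree of a vertex, for blocks of equal size. -/
lemma edgeMean_starEdges {N M : ℕ} (B : Fin N → Fin M) (p q : unitInterval) (hMN : M ∣ N)
    (hB : ∀ m : Fin M, (Finset.univ.filter fun v => B v = m).card = N / M) (v : Fin N) :
    edgeMean B p q (starEdges v) = (N * (p : ℝ) + N * ((M : ℝ) - 1) * q) / M := by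
  have hM : (0 : ℝ) < M := by exact_mod_cast (B v).pos
  rw [edgeMean, sum_starEdges]
  have h1 : ∀ w, ((edgeProb B p q s(v, w) : unitInterval) : ℝ) =
      q + if B w = B v then ((p : ℝ) - q) else 0 := by
    intro w
    rw [edgeProb_mk]
    by_cases h : B v = B w
    · simp [h]
    · simp [h, Ne.symm h]
  simp only [h1, Finset.sum_add_distrib, ← Finset.sum_filter, Finset.sum_const, nsmul_eq_mul, hB,
    Finset.card_univ, Fintype.card_fin, Nat.cast_div hMN hM.ne']
  field_simp
  ring

/-- With `s m` vertices of `S` in block `m`, the pairs inside blocks number `∑ s m (N/M - s m)`. By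
Cauchy–Schwarz this is at most a fraction `1/M ≤ 1/2` of all pairs across the cut. -/
lemma card_cross_ge {N M : ℕ} (B : Fin N → Fin M) (hMN : M ∣ N)
    (hB : ∀ m : Fin M, (Finset.univ.filter fun v => B v = m).card = N / M) (hM : 2 ≤ M)
    (S : Finset (Fin N)) :
    ((S.card : ℝ) * (N - S.card)) / 2 ≤ ∑ v ∈ S, ∑ w ∈ Sᶜ, if B v = B w then (0 : ℝ) else 1 := by
  classical
  have hMR : (2 : ℝ) ≤ M := by exact_mod_cast hM
  set s : Fin M → ℝ := fun m => ((S.filter fun v => B v = m).card : ℝ)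
  have hs : ∑ m, s m = S.card := by
    simp only [s]
    rw [← Nat.cast_sum, ← Finset.card_eq_sum_card_fiberwise (f := B) (t := Finset.univ) (by simp)]
  have hrow : ∀ v, ∑ w ∈ Sᶜ, (if B v = B w then (0 : ℝ) else 1) =
      (N - S.card) - (N / M - s (B v)) := by
    intro v
    have h1 : ∀ w, (if B v = B w then (0 : ℝ) else 1) = 1 - if B w = B v then 1 else 0 := fun w => by
      by_cases h : B v = B w
      · simp [h]
      · simp [h, Ne.symm h]
    have h2 : ∀ g : Fin N → ℝ, ∑ w ∈ Sᶜ, g w = ∑ w, g w - ∑ w ∈ S, g w := fun g => by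
      rw [← Finset.sum_add_sum_compl S]; ring
    simp only [h1]
    rw [h2]
    simp only [Finset.sum_sub_distrib, Finset.sum_boole, hB, Finset.sum_const, nsmul_eq_mul, mul_one,
      Finset.card_univ, Fintype.card_fin, Nat.cast_div hMN (by linarith : (M : ℝ) ≠ 0)]
    ring
  simp only [hrow]
  have hsq : ∑ v ∈ S, s (B v) = ∑ m, s m ^ 2 := by
    rw [← Finset.sum_fiberwise S B]
    refine Finset.sum_congr rfl fun m _ => ?_
    rw [Finset.sum_congr rfl (g := fun _ => s m) (by intro v hv; rw [(Finset.mem_filter.1 hv).2]),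
      Finset.sum_const, nsmul_eq_mul, sq]
  have hCS : (S.card : ℝ) ^ 2 ≤ M * ∑ m, s m ^ 2 := by
    have := sq_sum_le_card_mul_sum_sq (s := (Finset.univ : Finset (Fin M))) (f := s)
    rwa [hs, Finset.card_univ, Fintype.card_fin] at this
  have hle : (S.card : ℝ) ≤ N := by
    exact_mod_cast (Finset.card_le_univ S).trans_eq (Fintype.card_fin N)
  simp only [Finset.sum_sub_distrib, Finset.sum_const, hsq, nsmul_eq_mul]
  have h5 : (S.card : ℝ) ^ 2 / M ≤ ∑ m, s m ^ 2 := by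
    rw [div_le_iff₀ (by linarith)]; linarith
  have h6 : (S.card : ℝ) * (N / M) - S.card ^ 2 / M = (S.card * (N - S.card)) / M := by ring
  have h7 : ((S.card : ℝ) * (N - S.card)) / M ≤ (S.card * (N - S.card)) / 2 :=
    div_le_div_of_nonneg_left (mul_nonneg (Nat.cast_nonneg _) (by linarith)) (by norm_num) hMR
  linarith

lemma mul_le_edgeMean_cutEdges {N M : ℕ} (B : Fin N → Fin M) (p q : unitInterval) (hMN : M ∣ N)
    (hB : ∀ m : Fin M, (Finset.univ.filter fun v => B v = m).card = N / M) (hM : 2 ≤ M)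
    (S : Finset (Fin N)) :
    (q : ℝ) / 2 * (S.card * (N - S.card)) ≤ edgeMean B p q (cutEdges S) := by
  rw [edgeMean, sum_cutEdges]
  calc (q : ℝ) / 2 * (S.card * (N - S.card)) = q * ((S.card * (N - S.card)) / 2) := by ring
    _ ≤ q * ∑ v ∈ S, ∑ w ∈ Sᶜ, (if B v = B w then (0 : ℝ) else 1) :=
        mul_le_mul_of_nonneg_left (card_cross_ge B hMN hB hM S) q.2.1
    _ ≤ _ := by
        simp only [Finset.mul_sum]
        refine Finset.sum_le_sum fun v _ => Finset.sum_le_sum fun w _ => ?_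
        rw [edgeProb_mk]
        split_ifs
        · simpa using p.2.1
        · simp

lemma edgeMean_cutEdges_of_one {N : ℕ} (B : Fin N → Fin 1) (p q : unitInterval)
    (S : Finset (Fin N)) :
    (p : ℝ) * (S.card * (N - S.card)) = edgeMean B p q (cutEdges S) := by
  have hle : S.card ≤ N := (Finset.card_le_univ S).trans_eq (Fintype.card_fin N)
  rw [edgeMean, sum_cutEdges]
  simp only [edgeProb_mk, Subsingleton.elim (B _) 0, if_true, Finset.sum_const, nsmul_eq_mul,
    Finset.card_compl, Fintype.card_fin, Nat.cast_sub hle]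
  ring

/-- Degrees close to `d` up to a factor two, and cuts of density at least `ρ`. -/
def IsExpanding {N : ℕ} (d ρ : ℝ) (G : EdgeConfig N) : Prop :=
  (∀ v, d / 2 ≤ degree G v ∧ (degree G v : ℝ) ≤ 2 * d) ∧
    ∀ S : Finset (Fin N), 2 * S.card ≤ N →
      ρ * (S.card * (N - S.card)) ≤ ∑ v ∈ S, ∑ w ∈ Sᶜ, adjacency G v w

lemma measureReal_not_isExpanding_le {N M : ℕ} (B : Fin N → Fin M) (p q : unitInterval) {d r : ℝ}
    (hr : 0 ≤ r) (hd : ∀ v, edgeMean B p q (starEdges v) = d)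
    (hcut : ∀ S : Finset (Fin N), r * (S.card * (N - S.card)) ≤ edgeMean B p q (cutEdges S)) :
    (law B p q).real {G | ¬ IsExpanding d (r / 2) G} ≤
      2 * N * Real.exp (-d / 10) + ((1 + Real.exp (-(r * N) / 20)) ^ N - 1) := by
  classical
  set μ := law B p q
  set 𝒮 : Finset (Finset (Fin N)) := Finset.univ.filter fun S => S.Nonempty ∧ 2 * S.card ≤ N
  have hsub : {G : EdgeConfig N | ¬ IsExpanding d (r / 2) G} ⊆
      ((⋃ v ∈ (Finset.univ : Finset (Fin N)), {G | edgeCount (starEdges v) G ≤ edgeMean B p q (starEdges v) / 2}) ∪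
      (⋃ v ∈ (Finset.univ : Finset (Fin N)), {G | 2 * edgeMean B p q (starEdges v) ≤ edgeCount (starEdges v) G})) ∪
      ⋃ S ∈ 𝒮, {G | edgeCount (cutEdges S) G ≤ edgeMean B p q (cutEdges S) / 2} := by
    intro G hG
    by_contra hcon
    simp only [Set.mem_union, Set.mem_iUnion, Set.mem_ofPred_eq, Finset.mem_univ, exists_prop,
      true_and, not_or, not_exists, not_and, not_le, hd, edgeCount_starEdges, edgeCount_cutEdges] at hcon
    obtain ⟨⟨h1, h2⟩, h3⟩ := hcon
    refine hG ⟨fun v => ⟨(h1 v).le, (h2 v).le⟩, fun S hS => ?_⟩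
    rcases S.eq_empty_or_nonempty with rfl | hne
    · simp
    · have := h3 S (by simp [𝒮, hne, hS])
      linarith [hcut S]
  have b1 : μ.real (⋃ v ∈ (Finset.univ : Finset (Fin N)),
      {G | edgeCount (starEdges v) G ≤ edgeMean B p q (starEdges v) / 2}) ≤ N * Real.exp (-d / 10) := by
    refine (measureReal_biUnion_finset_le _ _).trans ?_
    refine (Finset.sum_le_sum fun v _ => measureReal_edgeCount_le B p q _ (hd v).ge).trans ?_
    simp
  have b2 : μ.real (⋃ v ∈ (Finset.univ : Finset (Fin N)),
      {G | 2 * edgeMean B p q (starEdges v) ≤ edgeCount (starEdges v) G}) ≤ N * Real.exp (-d / 10) := by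
    refine (measureReal_biUnion_finset_le _ _).trans ?_
    refine (Finset.sum_le_sum fun v _ => measureReal_edgeCount_ge B p q _ (hd v).ge).trans ?_
    simp
  have b3 : μ.real (⋃ S ∈ 𝒮, {G | edgeCount (cutEdges S) G ≤ edgeMean B p q (cutEdges S) / 2}) ≤
      (1 + Real.exp (-(r * N) / 20)) ^ N - 1 := by
    set x := Real.exp (-(r * N) / 20)
    have hx : 0 < x := Real.exp_pos _
    refine (measureReal_biUnion_finset_le _ _).trans ?_
    have h1 : ∀ S ∈ 𝒮, μ.real {G | edgeCount (cutEdges S) G ≤ edgeMean B p q (cutEdges S) / 2} ≤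
        x ^ S.card := by
      intro S hS
      simp only [𝒮, Finset.mem_filter] at hS
      have h2 : (2 : ℝ) * S.card ≤ N := by exact_mod_cast hS.2.2
      -- As `N - |S| ≥ N/2`, the failure probability decays geometrically in `|S|`; summing `x ^
      -- |S|` over nonempty sets gives at most `(1 + x) ^ N - 1`.
      have h3 : r * (S.card * (N / 2)) ≤ edgeMean B p q (cutEdges S) :=
        le_trans (by gcongr; linarith) (hcut S)
      refine (measureReal_edgeCount_le B p q _ h3).trans (le_of_eq ?_)
      rw [← Real.exp_nat_mul]
      congr 1; ring
    refine (Finset.sum_le_sum h1).trans ?_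
    have h4 : ∑ S ∈ 𝒮, x ^ S.card + 1 ≤ ∑ S : Finset (Fin N), x ^ S.card := by
      have hnot : (∅ : Finset (Fin N)) ∉ 𝒮 := by simp [𝒮]
      have : ∑ S ∈ insert ∅ 𝒮, x ^ S.card = 1 + ∑ S ∈ 𝒮, x ^ S.card := by
        rw [Finset.sum_insert hnot]; simp
      rw [add_comm, ← this]
      exact Finset.sum_le_sum_of_subset_of_nonneg (Finset.subset_univ _)
        fun S _ _ => (pow_pos hx _).le
    have h5 := Fintype.sum_pow_mul_eq_add_pow (Fin N) x 1
    simp only [one_pow, mul_one, Fintype.card_fin] at h5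
    rw [add_comm 1 x, ← h5]
    linarith
  calc μ.real {G | ¬ IsExpanding d (r / 2) G} ≤ _ := measureReal_mono hsub
    _ ≤ _ := (measureReal_union_le _ _).trans (add_le_add_left (measureReal_union_le _ _) _)
    _ ≤ _ := by linarith

/-! ### Translation of the asymptotic assumptions. -/

/-- The parameter regime used below: `L` plays the role of `log N`, and `d`, `s` are the expected
degree and the cut density times `N`. -/
structure Regime (c L d s : ℝ) : Prop where
  degree_ge : L / c ≤ d
  cut_ge : L / (2 * c) ≤ s
  degree_le : d ≤ 8 * c * s ^ 2

/-- Here `x = Np`, `y = Nq` and `m = M`; `h1` and `h2` are the two assumptions of the theorem with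
`o(·)` replaced by the factor `c`, the second one squared. -/
lemma regime_of_two_le {c L x y m : ℝ} (hc : 0 < c) (hc1 : c ≤ 1) (hL : 2 ≤ L) (hm : 2 ≤ m)
    (hx : 0 ≤ x) (hy : 0 ≤ y) (h1 : m * L ^ 4 ≤ c * (x + (m - 1) * y))
    (h2 : x * L ≤ c ^ 2 * y ^ 2 * m) : Regime c L ((x + (m - 1) * y) / m) (y / 2) := by
  have hm0 : 0 < m := by linarith
  have hL4 : L ≤ L ^ 4 := by nlinarith [pow_le_pow_right₀ (by linarith : 1 ≤ L) (by norm_num : 1 ≤ 4)]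
  -- If `c * y < L`, then `h2` bounds `x` as well, and `h1` would give `L ^ 3 ≤ 2`.
  have hcy : L ≤ c * y := by
    by_contra hlt
    push Not at hlt
    have hcy0 : 0 ≤ c * y := by positivity
    have e1 : m * L ^ 4 ≤ c * x + m * (c * y) := by nlinarith
    have e2 : m * L ^ 5 ≤ c * (x * L) + m * (c * y) * L := by nlinarith
    have e3 : (c * y) ^ 2 ≤ L ^ 2 := by gcongr
    have e4 : c * (x * L) ≤ m * L ^ 2 := by
      calc c * (x * L) ≤ 1 * (x * L) := by gcongr
        _ ≤ m * (c * y) ^ 2 := by linarith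
        _ ≤ m * L ^ 2 := by gcongr
    have e5 : m * (c * y) * L ≤ m * L ^ 2 := by
      have : m * (c * y) * L ≤ m * L * L := by gcongr
      linarith
    have e6 : L ^ 5 ≤ 2 * L ^ 2 := by
      refine le_of_mul_le_mul_left ?_ hm0
      linarith
    have e7 : (2 : ℝ) ^ 3 ≤ L ^ 3 := by gcongr
    nlinarith [pow_pos (by linarith : 0 < L) 2]
  refine ⟨?_, ?_, ?_⟩
  · rw [div_le_div_iff₀ hc hm0]
    nlinarith
  · rw [div_le_div_iff₀ (by positivity) two_pos]
    linarith
  · rw [div_le_iff₀ hm0]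
    have e1 : x ≤ c * y ^ 2 * m := by
      calc x ≤ x * L := by nlinarith
        _ ≤ c ^ 2 * y ^ 2 * m := h2
        _ ≤ c * y ^ 2 * m := by gcongr; nlinarith
    have e2 : (m - 1) * y ≤ c * y ^ 2 * m := by
      calc (m - 1) * y ≤ m * y * 1 := by nlinarith
        _ ≤ m * y * (c * y) := by gcongr; linarith
        _ = c * y ^ 2 * m := by ring
    linarith

lemma regime_of_one {c L x : ℝ} (hc : 0 < c) (hL : 2 ≤ L) (h1 : L ^ 4 ≤ c * x) :
    Regime c L x x := by
  have hL4 : L ≤ L ^ 4 := by nlinarith [pow_le_pow_right₀ (by linarith : 1 ≤ L) (by norm_num : 1 ≤ 4)]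
  have hx : 0 < x := by
    by_contra h
    push Not at h
    nlinarith
  refine ⟨?_, ?_, ?_⟩
  · rw [div_le_iff₀ hc]; linarith
  · rw [div_le_iff₀ (by positivity)]; nlinarith
  · nlinarith

lemma exists_regime {N M : ℕ} (B : Fin N → Fin M) (p q : unitInterval) (hMN : M ∣ N)
    (hB : ∀ m : Fin M, (Finset.univ.filter fun v => B v = m).card = N / M) (hN : 0 < N)
    {c : ℝ} (hc : 0 < c) (hc1 : c ≤ 1) (hL : 2 ≤ Real.log N)
    (h1 : (M : ℝ) * Real.log N ^ 4 ≤ c * (N * (p : ℝ) + N * ((M : ℝ) - 1) * q))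
    (h2 : √((p : ℝ) * Real.log N / (N * M)) ≤ c * q) :
    ∃ d r : ℝ, 0 < r ∧ (∀ v, edgeMean B p q (starEdges v) = d) ∧
      (∀ S : Finset (Fin N), r * (S.card * (N - S.card)) ≤ edgeMean B p q (cutEdges S)) ∧
      Regime c (Real.log N) d (r * N) := by
  have hM : 0 < M := (B ⟨0, hN⟩).pos
  have hNR : (0 : ℝ) < N := by exact_mod_cast hN
  have hMR : (0 : ℝ) < M := by exact_mod_cast hM
  have hp := p.2.1
  have hq := q.2.1
  have hcR : ∀ {d r : ℝ}, Regime c (Real.log N) d (r * N) → 0 < r := by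
    intro d r h
    have : 0 < r * N := lt_of_lt_of_le (by positivity) h.cut_ge
    exact pos_of_mul_pos_left this hNR.le
  -- With at least two blocks, the edges between blocks alone carry the cuts, at density `q / 2`;
  -- with a single block no such edges exist, and the density is `p`.
  rcases Nat.lt_or_ge 1 M with hM2 | hM1
  · have hreg := regime_of_two_le (x := N * p) (y := N * q) hc hc1 hL
      (by exact_mod_cast hM2 : (2 : ℝ) ≤ M) (by positivity) (by positivity)
      (h1.trans_eq (by ring)) (by
        have := Real.sqrt_le_iff.1 h2
        have h3 := this.2
        rw [div_le_iff₀ (by positivity)] at h3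
        nlinarith)
    have e : (q : ℝ) / 2 * N = N * q / 2 := by ring
    rw [← e] at hreg
    refine ⟨_, (q : ℝ) / 2, hcR hreg, fun v => ?_,
      mul_le_edgeMean_cutEdges B p q hMN hB hM2, hreg⟩
    rw [edgeMean_starEdges B p q hMN hB v]
    ring
  · obtain rfl : M = 1 := by omega
    have hreg := regime_of_one (x := p * N) hc hL (by simpa [mul_comm] using h1)
    refine ⟨_, (p : ℝ), hcR hreg, fun v => ?_,
      fun S => (edgeMean_cutEdges_of_one B p q S).le, hreg⟩
    rw [edgeMean_starEdges B p q hMN hB v]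
    simp [mul_comm]

/-! ### Conclusion: accuracy and probability. -/

lemma IsExpanding.abs_sub_one_le {N : ℕ} {G : EdgeConfig N} {c L d r ε : ℝ} (hc : 0 < c)
    (hL : 2 ≤ L) (hr : 0 < r) (hreg : Regime c L d (r * N)) (hG : IsExpanding d (r / 2) G)
    (hε : 2050 * c ≤ ε) (hN : 2 ≤ ε * N) (v : Fin N) :
    targetAveragedHittingTime G v ≠ ∞ ∧
      |(targetAveragedHittingTime G v).toReal / (N : ℝ) - 1| ≤ ε := by
  have hNR : (0 : ℝ) < N := by exact_mod_cast v.pos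
  have hd : 0 < d := lt_of_lt_of_le (by positivity) hreg.degree_ge
  obtain ⟨h1, h2, h3⟩ := targetAveragedHittingTime_bounds G (half_pos hd) (half_pos hr)
    (fun u => (hG.1 u).1) (fun u => (hG.1 u).2) hG.2 v
  refine ⟨h1, ?_⟩
  have e1 : (d / 2)⁻¹ ≤ c := by
    have := hreg.degree_ge
    rw [div_le_iff₀ hc] at this
    rw [inv_le_iff_one_le_mul₀ (by positivity)]
    linarith
  -- The term `1/(γδ)` with `δ = d/2`, `D = 2d` and density `r/2` equals `256 d / (rN)²`, and
  -- `Regime.degree_le` supplies another factor `8c`.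
  have e2 : 8 * (2 * d) ^ 2 / (r / 2 * N) ^ 2 * (d / 2)⁻¹ ≤ 2048 * c := by
    have e : 8 * (2 * d) ^ 2 / (r / 2 * N) ^ 2 * (d / 2)⁻¹ = 256 * d / (r * N) ^ 2 := by
      field_simp; ring
    rw [e, div_le_iff₀ (by positivity)]
    linarith [hreg.degree_le]
  have h4 : (targetAveragedHittingTime G v).toReal / N ≤ 1 + 2049 * c := by
    rw [div_le_iff₀ hNR, mul_comm]
    refine h3.trans (mul_le_mul_of_nonneg_left ?_ hNR.le)
    linarith
  have h5 : 1 - ε ≤ (targetAveragedHittingTime G v).toReal / N := by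
    rw [le_div_iff₀ hNR]
    linarith
  rw [abs_le]
  constructor <;> linarith

lemma measureReal_not_isExpanding_le_of_regime {N M : ℕ} (B : Fin N → Fin M) (p q : unitInterval)
    {c d r : ℝ} (hN : 0 < N) (hc : 0 < c) (hc1 : c ≤ 1 / 80) (hL : 2 ≤ Real.log N) (hr : 0 < r)
    (hd : ∀ v, edgeMean B p q (starEdges v) = d)
    (hcut : ∀ S : Finset (Fin N), r * (S.card * (N - S.card)) ≤ edgeMean B p q (cutEdges S))
    (hreg : Regime c (Real.log N) d (r * N)) :
    (law B p q).real {G | ¬ IsExpanding d (r / 2) G} ≤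
      2 * (N : ℝ)⁻¹ + (Real.exp (N : ℝ)⁻¹ - 1) := by
  have hNR : (0 : ℝ) < N := by exact_mod_cast hN
  refine (measureReal_not_isExpanding_le B p q hr.le hd hcut).trans ?_
  -- The bound `c ≤ 1/80` makes both exponents at least `2 log N`; the cut exponent `rN/20 ≥ log N /
  -- (40c)` is the binding one.
  have key : ∀ t : ℝ, 2 * Real.log N ≤ t → N * Real.exp (-t) ≤ (N : ℝ)⁻¹ := by
    intro t ht
    have : Real.exp (-t) ≤ Real.exp (-(Real.log N + Real.log N)) := Real.exp_le_exp.2 (by linarith)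
    rw [Real.exp_neg (_ + _), Real.exp_add, Real.exp_log hNR] at this
    calc N * Real.exp (-t) ≤ N * (N * N : ℝ)⁻¹ := by gcongr
      _ = (N : ℝ)⁻¹ := by field_simp
  have h1 : N * Real.exp (-d / 10) ≤ (N : ℝ)⁻¹ := by
    rw [neg_div]
    refine key _ ?_
    have := hreg.degree_ge
    rw [div_le_iff₀ hc] at this
    have hd0 : 0 ≤ d := le_trans (by positivity) hreg.degree_ge
    nlinarith
  have h2 : N * Real.exp (-(r * N) / 20) ≤ (N : ℝ)⁻¹ := by
    rw [neg_div]
    refine key _ ?_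
    have := hreg.cut_ge
    rw [div_le_iff₀ (by positivity)] at this
    have hs0 : 0 ≤ r * N := by positivity
    nlinarith
  have h3 : (1 + Real.exp (-(r * N) / 20)) ^ N ≤ Real.exp (N : ℝ)⁻¹ := by
    calc (1 + Real.exp (-(r * N) / 20)) ^ N ≤ (Real.exp (Real.exp (-(r * N) / 20))) ^ N := by
          have := (Real.exp_pos (-(r * N) / 20)).le
          gcongr
          rw [add_comm]
          exact Real.add_one_le_exp _
      _ = Real.exp (N * Real.exp (-(r * N) / 20)) := by rw [← Real.exp_nat_mul]
      _ ≤ _ := Real.exp_le_exp.2 h2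
  linarith

end StochasticBlockModel

theorem theorem7p1
    (N M : ℕ → ℕ) (B : (i : ℕ) → Fin (N i) → Fin (M i)) (p q : ℕ → unitInterval)
    (hN : Tendsto N atTop atTop)
    (hM : (fun i => (M i : ℝ)) =o[atTop] fun i => (N i : ℝ))
    (hMN : ∀ i, M i ∣ N i)
    (hB : ∀ i, ∀ m : Fin (M i), (Finset.univ.filter fun v => B i v = m).card = N i / M i)
    (hconn : (fun i => (M i : ℝ) * Real.log (N i) ^ 4) =o[atTop]
      fun i => (N i : ℝ) * (p i : ℝ) + (N i : ℝ) * ((M i : ℝ) - 1) * (q i : ℝ))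
    (hq : (fun i => √((p i : ℝ) * Real.log (N i) / ((N i : ℝ) * (M i : ℝ)))) =o[atTop]
      fun i => (q i : ℝ))
    (κ : ℝ≥0∞)
    (hκ : Tendsto
      (fun i => ENNReal.ofReal (((M i : ℝ) - 1) * (q i : ℝ)) / ENNReal.ofReal (p i : ℝ))
      atTop (𝓝 κ)) :
    ∀ ε : ℝ, 0 < ε →
      Tendsto
        (fun i => StochasticBlockModel.law (B i) (p i) (q i)
          {G | ∀ v : Fin (N i),
            StochasticBlockModel.targetAveragedHittingTime G v ≠ ∞ ∧
            |(StochasticBlockModel.targetAveragedHittingTime G v).toReal / (N i : ℝ) - 1| ≤ ε})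
        atTop (𝓝 1) := by
  intro ε hε
  -- `1/80` is for the union bounds; `ε/2050` leaves room for the total error `2049 c`.
  set c : ℝ := min (1 / 80) (ε / 2050)
  have hc : 0 < c := lt_min (by norm_num) (by positivity)
  have hc1 : c ≤ 1 / 80 := min_le_left _ _
  have hcε : 2050 * c ≤ ε := by
    have : c ≤ ε / 2050 := min_le_right _ _
    linarith
  have hNR : Tendsto (fun i => (N i : ℝ)) atTop atTop := tendsto_natCast_atTop_atTop.comp hN
  have hinv : Tendsto (fun i => (N i : ℝ)⁻¹) atTop (𝓝 0) := tendsto_inv_atTop_zero.comp hNR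
  have hbad : Tendsto (fun i => 2 * (N i : ℝ)⁻¹ + (Real.exp (N i : ℝ)⁻¹ - 1)) atTop (𝓝 0) := by
    have h1 := hinv.const_mul 2
    have h2 := ((Real.continuous_exp.tendsto 0).comp hinv).sub_const 1
    simpa using h1.add h2
  have hlow : Tendsto (fun i => ENNReal.ofReal
      (1 - (2 * (N i : ℝ)⁻¹ + (Real.exp (N i : ℝ)⁻¹ - 1)))) atTop (𝓝 1) := by
    have := ENNReal.tendsto_ofReal (hbad.const_sub 1)
    simpa using this
  refine tendsto_of_tendsto_of_tendsto_of_le_of_le' hlow tendsto_const_nhds ?_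
    (Eventually.of_forall fun i => prob_le_one)
  filter_upwards [hconn.def hc, hq.def hc, hN.eventually_gt_atTop 0,
    (Real.tendsto_log_atTop.comp hNR).eventually_ge_atTop 2,
    hNR.eventually_ge_atTop (2 / ε)] with i h1 h2 hNi hLi hNε
  have hL0 : 2 ≤ Real.log (N i) := hLi
  have hM0 : 0 < M i := (B i ⟨0, hNi⟩).pos
  have hM1 : (1 : ℝ) ≤ M i := by exact_mod_cast hM0
  have hp := (p i).2.1
  have hq0 := (q i).2.1
  rw [Real.norm_of_nonneg (by positivity), Real.norm_of_nonneg (by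
    have : 0 ≤ (M i : ℝ) - 1 := by linarith
    positivity)] at h1
  rw [Real.norm_of_nonneg (Real.sqrt_nonneg _), Real.norm_of_nonneg hq0] at h2
  obtain ⟨d, r, hr, hd, hcut, hreg⟩ := StochasticBlockModel.exists_regime (B i) (p i) (q i) (hMN i)
    (hB i) hNi hc (hc1.trans (by norm_num)) hL0 h1 h2
  have hprob := StochasticBlockModel.measureReal_not_isExpanding_le_of_regime (B i) (p i) (q i)
    hNi hc hc1 hL0 hr hd hcut hreg
  have hcompl : {G | ¬ StochasticBlockModel.IsExpanding d (r / 2) G} =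
      {G : StochasticBlockModel.EdgeConfig (N i) |
        StochasticBlockModel.IsExpanding d (r / 2) G}ᶜ := rfl
  rw [hcompl, probReal_compl_eq_one_sub MeasurableSet.of_discrete] at hprob
  have hmono : {G : StochasticBlockModel.EdgeConfig (N i) |
      StochasticBlockModel.IsExpanding d (r / 2) G} ⊆
      {G | ∀ v : Fin (N i), StochasticBlockModel.targetAveragedHittingTime G v ≠ ∞ ∧
        |(StochasticBlockModel.targetAveragedHittingTime G v).toReal / (N i : ℝ) - 1| ≤ ε} :=
    fun G hG v => hG.abs_sub_one_le hc hL0 hr hreg hcε (by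
      rw [div_le_iff₀ hε] at hNε; linarith) v
  refine le_trans ?_ (measure_mono hmono)
  rw [← ofReal_measureReal]
  exact ENNReal.ofReal_le_ofReal (by linarith)
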